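/- Let $n>2k\ge 6$ be integers; write $[a,b]=\{a,a+1,\dots,b\}$, $[n]=[1,n]$, and $\binom{X}{r}$ for the family of all $r$-element subsets of $X$. For finite sets $A,B$ of positive integers write $A\le B$ if $A\supseteq B$ or the minimal element of $A\setminus B$ is smaller than the minimal element of $B\setminus A$, and $A<B$ if $A\le B$ and $A\ne B$. For $S\subset[n]$ put $\mathcal L(S,a)=\{A\in\binom{[2,n]}{a}: A\le S\cap[2,n]\}$. Sets $S\subset[n]$ and $T\subset[2,n]$ form a *resistant pair* if either $S=\{1,4\}$ and $T=\{2,3,4\}$, or the largest element $j$ of $T$ exists and satisfies $j\ge 4$, $S\cap T=\{j\}$, $S\cup T=[j]$, $|S|\le k$, $|T|\le k$, and $|[i]\cap S|<|[i]\setminus S|$ for every $4\le i\le j$. Let $(S_1,T_1),\dots,(S_m,T_m)$ be all the resistant pairs, and put $T_0=[2,n]$, $S_0=\{1,n\}$ (so that $\mathcal L(T_0,k)=\emptyset$ and $\mathcal L(S_0,k-1)=\binom{[2,n]}{k-1}$); number the pairs so that $T_0<T_1<\dots<T_m$. Then for each $l\in\{1,\dots,m\}$: 1. $|\mathcal L(S_{l-1},k-1)|+|\mathcal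 L(T_{l-1},k)|>|\mathcal L(S_l,k-1)|+|\mathcal L(T_l,k)|$. 2. If $\mathcal A\subset\binom{[2,n]}{k-1}$ and $\mathcal B\subset\binom{[2,n]}{k}$ are cross-intersecting (that is, $A\cap B\neq\emptyset$ for all $A\in\mathcal A$, $B\in\mathcal B$) and $|\mathcal L(T_{l-1},k)|<|\mathcal B|\le|\mathcal L(T_l,k)|$, then $|\mathcal A|+|\mathcal B|\le|\mathcal L(S_l,k-1)|+|\mathcal L(T_l,k)|$. 3. If $\mathcal F\subset\binom{[n]}{k}$ is intersecting and its diversity $\gamma(\mathcal F)=|\mathcal F|-\max_{i\in[n]}|\{F\in\mathcal F:i\in F\}|$ satisfies $|\mathcal L(T_{l-1},k)|<\gamma(\mathcal F)\le|\mathcal L(T_l,k)|$, then $|\mathcal F|\le|\mathcal L(S_l,k-1)|+|\mathcal L(T_l,k)|$. -/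

import Mathlib

open Finset

/-- The lexicographical order on finite sets (non-strict): `A ≤ B` iff `A ⊇ B`, or the minimal
element of `A \ B` is smaller than the minimal element of `B \ A`. -/
def LexLE (A B : Finset ℕ) : Prop :=
  B ⊆ A ∨ ∃ a ∈ A \ B, ∀ b ∈ B \ A, a < b

/-- The strict lexicographical order. -/
def LexLT (A B : Finset ℕ) : Prop :=
  LexLE A B ∧ A ≠ B

open Classical in
/-- The lexicographic family `𝓛(S, a)`: all `a`-element subsets of `[2, n]` that do not come after
`S ∩ [2, n]` in the lexicographical order. -/
noncomputable def lexFamily (n : ℕ) (S : Finset ℕ) (a : ℕ) : Finset (Finset ℕ) :=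
  (powersetCard a (Icc 2 n)).filter fun A => LexLE A (S ∩ Icc 2 n)

/-- `S ⊆ [n]` and `T ⊆ [2, n]` form a resistant pair (for `k`-element sets). The number `j` is the
largest element of `T`, and the pair `({1, 4}, {2, 3, 4})` is included by convention. -/
def IsResistantPair (n k : ℕ) (S T : Finset ℕ) : Prop :=
  S ⊆ Icc 1 n ∧ T ⊆ Icc 2 n ∧
    ((∃ j, 4 ≤ j ∧ IsGreatest (T : Set ℕ) j ∧
        S ∩ T = {j} ∧ S ∪ T = Icc 1 j ∧ #S ≤ k ∧ #T ≤ k ∧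
        ∀ i, 4 ≤ i → i ≤ j → #(Icc 1 i ∩ S) < #(Icc 1 i \ S)) ∨
      (S = {1, 4} ∧ T = {2, 3, 4}))

/-- `(S 1, T 1), …, (S m, T m)` are all the resistant pairs, listed so that
`T 0 < T 1 < ⋯ < T m`, where `T 0 = [2, n]` and its partner `S 0 = {1, n}` are the characteristic
sets of the empty family of `k`-sets and of the family of all `(k - 1)`-subsets of `[2, n]`. -/
structure IsResistantEnumeration (n k m : ℕ) (S T : ℕ → Finset ℕ) : Prop where
  S_zero : S 0 = {1, n}
  T_zero : T 0 = Icc 2 n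
  lt_succ : ∀ l, l < m → LexLT (T l) (T (l + 1))
  pair_iff : ∀ P Q : Finset ℕ,
    IsResistantPair n k P Q ↔ ∃ l, 1 ≤ l ∧ l ≤ m ∧ S l = P ∧ T l = Q

/-- Every member of `𝒜` meets every member of `ℬ`. -/
def CrossIntersecting (𝒜 ℬ : Finset (Finset ℕ)) : Prop :=
  ∀ A ∈ 𝒜, ∀ B ∈ ℬ, (A ∩ B).Nonempty

/-- The number of members of `ℱ` that contain `i`. -/
def familyDegree (ℱ : Finset (Finset ℕ)) (i : ℕ) : ℕ :=
  #{F ∈ ℱ | i ∈ F}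

/-- The maximal degree of an element of `[n]` in `ℱ`. -/
def familyMaxDegree (n : ℕ) (ℱ : Finset (Finset ℕ)) : ℕ :=
  (Icc 1 n).sup (familyDegree ℱ)

/-- The diversity: the size of `ℱ` minus its maximal degree (which never exceeds the size). -/
def diversity (n : ℕ) (ℱ : Finset (Finset ℕ)) : ℕ :=
  #ℱ - familyMaxDegree n ℱ

/-!
For an initial segment of the lexicographical order on `k`-subsets of `[2, n]` with last member `U`,
the `(k - 1)`-sets that meet all its members are those whose complement in `[2, n]` comes after `U`.
So, by the Kruskal-Katona theorem (`CrossIntersecting.exists_countLE`), a cross-intersecting pair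
with `#ℬ` equal to the length of this segment has total size at most
`(n - 1).choose (k - 1) - gainLE n k U n`, where `gainLE` counts the `(n - k)`-sets not after `U`
minus the `k`-sets not after `U`. The same formula, with `T` in place of `U` and the greatest element
`j` of `T` in place of `n`, gives the total size of the two families attached to a resistant pair
`(S, T)` (`card_lexFamily_add_card_lexFamily`). Everything is thereby reduced to comparing gains.

A gain is computed along the characteristic word of `U`: the sets not after `U` fall into blocks,
given by a trace on `[2, i]` of some size `x`, and a block contributes
`C(n - i, n - k - x) - C(n - i, k - x)`. For `x ≤ k` this is positive if `2 * x > i` and at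
most zero otherwise (`gain_pos`, `gain_nonpos`): it tells whether the elements of the trace are a
majority in `[i]`. Pascal's rule describes how the gain changes when the word is read one letter
further: at a letter in `U` the block with that letter removed is lost, and at a letter outside `U`
nothing changes.

A set `T` other than `{2, 3, 4}` is resistant when its elements are a strict majority in `[i]` for
`4 ≤ i < j` and end with an excess of at least three. Hence all blocks between two resistant words
have nonnegative gain and the last one has positive gain, so that gains increase strictly along
resistant words (`ResistantWord.gainLE_lt_gainLE`). Conversely let `U` lie between two consecutive
resistant words. The later one has to be the longest resistant truncation of `U`. Beyond it, as
long as the majority lasts, a letter in `U` raises the excess to two at most, so the block lost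
there has gain at most zero; and once the excess has dropped to zero, the rest of the word cannot
lower the gain (`gain_tail_of_balance`). So the gain of `U` is at least that of the resistant word
(`IsResistantEnumeration.gainLE_le`).

The statement on diversity follows by splitting an intersecting family according to an element of
maximal degree, moved to `1`.
-/

/-! ### Binomial coefficients and gains -/

lemma choose_lt_choose_of_lt_of_add_lt {c a b : ℕ} (hab : a < b) (h : a + b < c) :
    c.choose a < c.choose b := by
  -- below the middle the coefficients increase strictly, and beyond it symmetry takes over
  have key : ∀ b, a < b → 2 * b ≤ c → c.choose a < c.choose b := by
    intro b hb
    induction b, hb using Nat.le_induction with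
    | base =>
      intro hc
      have h1 := Nat.choose_succ_right_eq c a
      have h2 : 0 < c.choose a := Nat.choose_pos (by omega)
      by_contra hcon
      have h3 : c.choose (a + 1) * (a + 1) ≤ c.choose a * (a + 1) :=
        Nat.mul_le_mul_right _ (not_lt.1 hcon)
      rw [h1] at h3
      have := Nat.le_of_mul_le_mul_left h3 h2
      omega
    | succ m hm ih =>
      intro hc
      exact (ih (by omega)).trans_le (Nat.choose_le_succ_of_lt_half_left (by omega))
  by_cases hb : 2 * b ≤ c
  · exact key b hab hb
  · by_cases hbc : b ≤ c
    · rw [← Nat.choose_symm hbc]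
      exact key _ (by omega) (by omega)
    · omega

lemma choose_le_choose_of_le_of_add_le {c a b : ℕ} (hab : a ≤ b) (h : a + b ≤ c) :
    c.choose a ≤ c.choose b := by
  rcases hab.eq_or_lt with rfl | hab
  · exact le_rfl
  rcases h.eq_or_lt with rfl | h
  · exact (Nat.choose_symm_add).le
  · exact (choose_lt_choose_of_lt_of_add_lt hab h).le

/-- The number of `r`-element subsets of `[2, n]` whose trace on `[2, i]` is a prescribed set of
size `x`. -/
def blockCard (n r x i : ℕ) : ℤ :=
  if x ≤ r then ((n - i).choose (r - x) : ℤ) else 0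

lemma blockCard_nonneg (n r x i : ℕ) : 0 ≤ blockCard n r x i := by
  unfold blockCard; split_ifs <;> positivity

/-- Pascal's rule: a block splits according to whether `i + 1` is a member. -/
lemma blockCard_split {n i : ℕ} (r x : ℕ) (h : i < n) :
    blockCard n r x i = blockCard n r (x + 1) (i + 1) + blockCard n r x (i + 1) := by
  unfold blockCard
  obtain ⟨m, hm⟩ : ∃ m, n - i = m + 1 := ⟨n - i - 1, by omega⟩
  have hm' : n - (i + 1) = m := by omega
  rw [hm, hm']
  rcases lt_trichotomy x r with h | rfl | h
  · obtain ⟨q, hq⟩ : ∃ q, r - x = q + 1 := ⟨r - x - 1, by omega⟩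
    have hq' : r - (x + 1) = q := by omega
    rw [if_pos h.le, if_pos (by omega), if_pos h.le, hq, hq', Nat.choose_succ_succ]
    push_cast; ring
  · simp
  · rw [if_neg (by omega), if_neg (by omega), if_neg (by omega)]; rfl

/-- The gain of a block: the number of `(n - k)`-sets with a prescribed trace of size `x` on
`[2, i]`, minus the number of `k`-sets with that trace. The complements of the former in `[2, n]` are
the `(k - 1)`-sets that miss some member of the latter block. -/
def gain (n k x i : ℕ) : ℤ :=
  blockCard n (n - k) x i - blockCard n k x i

lemma gain_split {n i : ℕ} (k x : ℕ) (h : i < n) :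
    gain n k x i = gain n k (x + 1) (i + 1) + gain n k x (i + 1) := by
  unfold gain
  rw [blockCard_split (n - k) x h, blockCard_split k x h]; ring

lemma gain_nonneg {n k x i : ℕ} (hn : 2 * k < n) (hi : i ≤ n) (hx : i ≤ 2 * x) :
    0 ≤ gain n k x i := by
  by_cases hk : x ≤ k
  · unfold gain blockCard
    rw [if_pos hk, if_pos (by omega), sub_nonneg]
    exact_mod_cast choose_le_choose_of_le_of_add_le (by omega) (by omega)
  · have h : blockCard n k x i = 0 := if_neg hk
    rw [gain, h, sub_zero]
    exact blockCard_nonneg ..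

lemma gain_pos {n k x i : ℕ} (hn : 2 * k < n) (hi : i ≤ n) (hx : i < 2 * x) (hk : x ≤ k) :
    0 < gain n k x i := by
  unfold gain blockCard
  rw [if_pos hk, if_pos (by omega), sub_pos]
  exact_mod_cast choose_lt_choose_of_lt_of_add_lt (by omega) (by omega)

lemma gain_nonpos {n k x i : ℕ} (hn : 2 * k < n) (hi : i ≤ n) (hx : 2 * x ≤ i) (hk : x ≤ k) :
    gain n k x i ≤ 0 := by
  unfold gain blockCard
  rw [if_pos hk, if_pos (by omega), sub_nonpos]
  by_cases h : n - k - x ≤ n - i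
  · rw [← Nat.choose_symm h]
    exact_mod_cast choose_le_choose_of_le_of_add_le (by omega) (by omega)
  · rw [Nat.choose_eq_zero_of_lt (not_le.1 h)]
    positivity

/-! ### Gains along the characteristic word of a set -/

/-- The number of elements of `U` in `[2, i]`. -/
def prefixCard (U : Finset ℕ) (i : ℕ) : ℕ := #(U ∩ Icc 2 i)

lemma prefixCard_succ_of_mem {U : Finset ℕ} {i : ℕ} (hi : 1 ≤ i) (h : i + 1 ∈ U) :
    prefixCard U (i + 1) = prefixCard U i + 1 := by
  have h1 : U ∩ Icc 2 (i + 1) = insert (i + 1) (U ∩ Icc 2 i) := by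
    ext x; simp only [mem_inter, mem_insert, mem_Icc]; grind
  rw [prefixCard, prefixCard, h1, card_insert_of_notMem (by simp)]

lemma prefixCard_succ_of_notMem {U : Finset ℕ} {i : ℕ} (h : i + 1 ∉ U) :
    prefixCard U (i + 1) = prefixCard U i := by
  have h1 : U ∩ Icc 2 (i + 1) = U ∩ Icc 2 i := by
    ext x; simp only [mem_inter, mem_Icc]; grind
  rw [prefixCard, prefixCard, h1]

lemma prefixCard_congr {U V : Finset ℕ} {i : ℕ} (h : ∀ x, 2 ≤ x → x ≤ i → (x ∈ U ↔ x ∈ V)) :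
    prefixCard U i = prefixCard V i := by
  unfold prefixCard; congr 1; ext x; simp only [mem_inter, mem_Icc]; grind

lemma prefixCard_le_card (U : Finset ℕ) (i : ℕ) : prefixCard U i ≤ #U :=
  card_le_card inter_subset_left

/-- The number of `r`-element subsets of `[2, n]` whose trace on `[2, i]` comes strictly before that
of `U` in the lexicographical order: such a trace agrees with `U` up to some `t ∉ U`, which it
contains. -/
def countLT (n r : ℕ) (U : Finset ℕ) (i : ℕ) : ℤ :=
  ∑ t ∈ Icc 2 i \ U, blockCard n r (prefixCard U (t - 1) + 1) t

/-- The number of `r`-element subsets of `[2, n]` whose trace on `[2, i]` does not come after that of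
`U` in the lexicographical order. -/
def countLE (n r : ℕ) (U : Finset ℕ) (i : ℕ) : ℤ :=
  countLT n r U i + blockCard n r (prefixCard U i) i

/-- The total gain of the blocks of level `i` that come strictly before `U`. -/
def gainLT (n k : ℕ) (U : Finset ℕ) (i : ℕ) : ℤ :=
  countLT n (n - k) U i - countLT n k U i

/-- The total gain of the blocks of level `i` up to the one that contains `U`. -/
def gainLE (n k : ℕ) (U : Finset ℕ) (i : ℕ) : ℤ :=
  countLE n (n - k) U i - countLE n k U i

lemma gainLE_eq (n k : ℕ) (U : Finset ℕ) (i : ℕ) :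
    gainLE n k U i = gainLT n k U i + gain n k (prefixCard U i) i := by
  unfold gainLE gainLT countLE gain; ring

lemma countLT_succ_of_mem {n r i : ℕ} {U : Finset ℕ} (h : i + 1 ∈ U) :
    countLT n r U (i + 1) = countLT n r U i := by
  unfold countLT; congr 1; ext x; simp only [mem_sdiff, mem_Icc]; grind

lemma countLT_succ_of_notMem {n r i : ℕ} {U : Finset ℕ} (hi : 1 ≤ i) (h : i + 1 ∉ U) :
    countLT n r U (i + 1) = countLT n r U i + blockCard n r (prefixCard U i + 1) (i + 1) := by
  have h1 : Icc 2 (i + 1) \ U = insert (i + 1) (Icc 2 i \ U) := by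
    ext x; simp only [mem_sdiff, mem_insert, mem_Icc]; grind
  rw [countLT, countLT, h1, sum_insert (by simp), add_comm, Nat.add_sub_cancel]

lemma gainLT_succ_of_mem {n k i : ℕ} {U : Finset ℕ} (h : i + 1 ∈ U) :
    gainLT n k U (i + 1) = gainLT n k U i := by
  rw [gainLT, gainLT, countLT_succ_of_mem h, countLT_succ_of_mem h]

lemma gainLT_succ_of_notMem {n k i : ℕ} {U : Finset ℕ} (hi : 1 ≤ i) (h : i + 1 ∉ U) :
    gainLT n k U (i + 1) = gainLT n k U i + gain n k (prefixCard U i + 1) (i + 1) := by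
  rw [gainLT, gainLT, countLT_succ_of_notMem hi h, countLT_succ_of_notMem hi h, gain]; ring

lemma gainLE_succ_of_mem {n k i : ℕ} {U : Finset ℕ} (hi : 1 ≤ i) (hin : i < n) (h : i + 1 ∈ U) :
    gainLE n k U (i + 1) = gainLE n k U i - gain n k (prefixCard U i) (i + 1) := by
  rw [gainLE_eq, gainLE_eq, gainLT_succ_of_mem h, prefixCard_succ_of_mem hi h,
    gain_split k (prefixCard U i) hin]
  ring

lemma gainLE_succ_of_notMem {n k i : ℕ} {U : Finset ℕ} (hi : 1 ≤ i) (hin : i < n)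
    (h : i + 1 ∉ U) : gainLE n k U (i + 1) = gainLE n k U i := by
  rw [gainLE_eq, gainLE_eq, gainLT_succ_of_notMem hi h, prefixCard_succ_of_notMem h,
    gain_split k (prefixCard U i) hin]
  ring

lemma gainLT_congr {n k i : ℕ} {U V : Finset ℕ}
    (h : ∀ x, 2 ≤ x → x ≤ i → (x ∈ U ↔ x ∈ V)) : gainLT n k U i = gainLT n k V i := by
  have key : ∀ r, countLT n r U i = countLT n r V i := by
    intro r
    unfold countLT
    have h1 : Icc 2 i \ U = Icc 2 i \ V := by
      ext x; simp only [mem_sdiff, mem_Icc]; grind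
    rw [h1]
    refine sum_congr rfl fun t ht => ?_
    rw [mem_sdiff, mem_Icc] at ht
    rw [prefixCard_congr (V := V) fun x hx hx' => h x hx (by omega)]
  rw [gainLT, gainLT, key, key]

lemma gainLE_congr {n k i : ℕ} {U V : Finset ℕ}
    (h : ∀ x, 2 ≤ x → x ≤ i → (x ∈ U ↔ x ∈ V)) : gainLE n k U i = gainLE n k V i := by
  rw [gainLE_eq, gainLE_eq, gainLT_congr h, prefixCard_congr h]

/-- If two words agree before `i + 1` and only `V` contains `i + 1`, then `V` immediately precedes
`W` among the traces on `[2, i + 1]`. -/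
lemma gainLE_eq_gainLT_of_agree {n k i : ℕ} {V W : Finset ℕ} (hi : 1 ≤ i)
    (h : ∀ x, 2 ≤ x → x ≤ i → (x ∈ V ↔ x ∈ W)) (hV : i + 1 ∈ V) (hW : i + 1 ∉ W) :
    gainLE n k V (i + 1) = gainLT n k W (i + 1) := by
  rw [gainLE_eq, gainLT_succ_of_mem hV, gainLT_succ_of_notMem hi hW, gainLT_congr h,
    prefixCard_succ_of_mem hi hV, prefixCard_congr h]

/-! ### Monotonicity of the gain along resistant sets -/

/-- The condition on the larger set `T`, with greatest element `j`, of a resistant pair, in terms of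
its characteristic word: elements of `T` strictly outnumber the other elements of `[i]` whenever
`4 ≤ i < j`, and by at least three for `i = j`; the set `{2, 3, 4}` is included by convention. -/
def ResistantWord (k : ℕ) (T : Finset ℕ) (j : ℕ) : Prop :=
  T ⊆ Icc 2 j ∧ j ∈ T ∧ #T ≤ k ∧ (∀ i, 4 ≤ i → i < j → i < 2 * prefixCard T i) ∧
    (5 ≤ j ∧ j + 3 ≤ 2 * prefixCard T j ∨ j = 4 ∧ T = {2, 3, 4})

/-- Past `2, 3, 4`, every block omitted by the word `V` before its end has nonnegative gain. -/
lemma gainLE_antitone_of_majority {n k a b : ℕ} {V : Finset ℕ} (hn : 2 * k < n) (ha : 4 ≤ a)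
    (hab : a ≤ b) (hb : b ≤ n) (hV : ∀ i, 4 ≤ i → i < b → i < 2 * prefixCard V i) :
    gainLE n k V b ≤ gainLE n k V a := by
  induction b, hab using Nat.le_induction with
  | base => exact le_rfl
  | succ m hm ih =>
    refine le_trans ?_ (ih (by omega) fun i h h' => hV i h (by omega))
    by_cases h : m + 1 ∈ V
    · rw [gainLE_succ_of_mem (by omega) (by omega) h]
      have := hV m (by omega) (by omega)
      have := gain_nonneg (x := prefixCard V m) hn hb (by omega)
      omega
    · rw [gainLE_succ_of_notMem (by omega) (by omega) h]

lemma gainLT_monotone_of_majority {n k a b : ℕ} {W : Finset ℕ} (hn : 2 * k < n) (ha : 4 ≤ a)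
    (hab : a ≤ b) (hb : b ≤ n) (hW : ∀ i, 4 ≤ i → i < b → i < 2 * prefixCard W i) :
    gainLT n k W a ≤ gainLT n k W b := by
  induction b, hab using Nat.le_induction with
  | base => exact le_rfl
  | succ m hm ih =>
    refine le_trans (ih (by omega) fun i h h' => hW i h (by omega)) ?_
    by_cases h : m + 1 ∈ W
    · rw [gainLT_succ_of_mem h]
    · rw [gainLT_succ_of_notMem (by omega) h]
      have := hW m (by omega) (by omega)
      have := gain_nonneg (x := prefixCard W m + 1) hn hb (by omega)
      omega

namespace ResistantWord

variable {k j : ℕ} {T : Finset ℕ}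

lemma four_le (h : ResistantWord k T j) : 4 ≤ j := by
  rcases h.2.2.2.2 with h | h <;> omega

lemma prefixCard_end (h : ResistantWord k T j) : j + 2 ≤ 2 * prefixCard T j := by
  rcases h.2.2.2.2 with h | ⟨rfl, rfl⟩
  · omega
  · decide

lemma prefixCard_le (h : ResistantWord k T j) (i : ℕ) : prefixCard T i ≤ k :=
  (prefixCard_le_card T i).trans h.2.2.1

/-- A resistant word starts with `2, 3, 4`. -/
lemma mem_of_le_four (h : ResistantWord k T j) {x : ℕ} (hx : 2 ≤ x) (hx' : x ≤ 4) : x ∈ T := by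
  have h4 : 4 < 2 * prefixCard T 4 := by
    rcases h.four_le.eq_or_lt with rfl | hj
    · have := h.prefixCard_end; omega
    · exact h.2.2.2.1 4 le_rfl hj
  by_contra hxT
  have : T ∩ Icc 2 4 ⊆ (Icc 2 4).erase x := by
    intro y hy
    rw [mem_inter] at hy
    exact mem_erase.2 ⟨fun e => hxT (e ▸ hy.1), hy.2⟩
  have := card_le_card this
  rw [card_erase_of_mem (mem_Icc.2 ⟨hx, hx'⟩), Nat.card_Icc] at this
  unfold prefixCard at h4
  omega

lemma le_of_mem (h : ResistantWord k T j) {x : ℕ} (hx : x ∈ T) : 2 ≤ x ∧ x ≤ j :=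
  mem_Icc.1 (h.1 hx)

lemma gainLT_four (h : ResistantWord k T j) (n : ℕ) : gainLT n k T 4 = 0 := by
  have : Icc 2 4 \ T = ∅ := by
    rw [sdiff_eq_empty_iff_subset]
    intro x hx
    rw [mem_Icc] at hx
    exact h.mem_of_le_four hx.1 hx.2
  simp [gainLT, countLT, this]

lemma gainLT_lt_gainLE {n : ℕ} (h : ResistantWord k T j) (hn : 2 * k < n) (hj : j ≤ n) :
    gainLT n k T j < gainLE n k T j := by
  rw [gainLE_eq]
  have := h.prefixCard_end
  have := gain_pos hn hj (by omega) (h.prefixCard_le j)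
  omega

lemma gainLE_pos {n : ℕ} (h : ResistantWord k T j) (hn : 2 * k < n) (hj : j ≤ n) :
    0 < gainLE n k T j := by
  have h1 := gainLT_monotone_of_majority hn le_rfl h.four_le hj h.2.2.2.1
  rw [h.gainLT_four] at h1
  exact h1.trans_lt (h.gainLT_lt_gainLE hn hj)

/-- If `U` agrees with a resistant word `T` before `x`, and `x` belongs to `U` but not to `T`, then
`U` cut off at `x` is resistant: `T` has a majority in `[x]` without `x`, so the excess of `U` there
is at least three. -/
lemma truncate_of_agree {U : Finset ℕ} {x : ℕ} (h : ResistantWord k T j) (hx : x < j)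
    (hU : ∀ y, 2 ≤ y → y < x → (y ∈ U ↔ y ∈ T)) (hx2 : 2 ≤ x) (hxU : x ∈ U) (hxT : x ∉ T)
    (hUk : #U ≤ k) : ResistantWord k (U ∩ Icc 2 x) x := by
  have h5 : 5 ≤ x := by
    by_contra hcon
    exact hxT (h.mem_of_le_four hx2 (by omega))
  have hagree : ∀ y, 2 ≤ y → y < x → (y ∈ U ∩ Icc 2 x ↔ y ∈ T) := by
    intro y hy hy'
    rw [mem_inter, mem_Icc, hU y hy hy']
    simp [hy, hy'.le]
  obtain ⟨z, rfl⟩ : ∃ z, x = z + 1 := ⟨x - 1, by omega⟩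
  refine ⟨inter_subset_right, mem_inter.2 ⟨hxU, mem_Icc.2 ⟨hx2, le_rfl⟩⟩,
    (card_le_card inter_subset_left).trans hUk, ?_, Or.inl ⟨h5, ?_⟩⟩
  · intro i hi hi'
    rw [prefixCard_congr (V := T) fun y hy hy' => hagree y hy (by omega)]
    exact h.2.2.2.1 i hi (by omega)
  · rw [prefixCard_succ_of_mem (by omega) (by simp [hxU, hx2]),
      prefixCard_congr (V := T) fun y hy hy' => hagree y hy (by omega),
      ← prefixCard_succ_of_notMem hxT]
    have := h.2.2.2.1 (z + 1) (by omega) hx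
    omega

/-- The gain increases strictly along resistant words. -/
lemma gainLE_lt_gainLE {n j' : ℕ} {V W : Finset ℕ} (hn : 2 * k < n)
    (hV : ResistantWord k V j) (hW : ResistantWord k W j') (hj : j ≤ n) (hj' : j' ≤ n)
    (hne : V ≠ W) (hlt : LexLE V W) : gainLE n k V j < gainLE n k W j' := by
  -- the first place where the words differ
  have hex : ∃ x, ¬ (x ∈ V ↔ x ∈ W) := by
    by_contra hcon
    push Not at hcon
    exact hne (ext hcon)
  classical
  obtain ⟨x, hx, hmin⟩ : ∃ x, ¬ (x ∈ V ↔ x ∈ W) ∧ ∀ y < x, (y ∈ V ↔ y ∈ W) :=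
    ⟨Nat.find hex, Nat.find_spec hex, fun y hy => not_not.1 (Nat.find_min hex hy)⟩
  have hxV : x ∈ V ∧ x ∉ W := by
    rcases hlt with hs | ⟨a, ha, hab⟩
    · exact ⟨by grind, by grind⟩
    · rw [mem_sdiff] at ha
      have hax : x ≤ a := by
        by_contra hcon
        have := hmin a (by omega)
        tauto
      by_contra hcon
      have : x ∈ W \ V := by rw [mem_sdiff]; tauto
      have := hab x this
      omega
  have hx2 := hV.le_of_mem hxV.1
  have hx5 : 5 ≤ x := by
    by_contra hcon
    exact hxV.2 (hW.mem_of_le_four hx2.1 (by omega))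
  obtain ⟨z, rfl⟩ : ∃ z, x = z + 1 := ⟨x - 1, by omega⟩
  rcases le_or_gt (z + 1) j' with hxj | hxj
  · -- the words diverge inside `W`, which comes later
    calc gainLE n k V j ≤ gainLE n k V (z + 1) :=
          gainLE_antitone_of_majority hn (by omega) hx2.2 hj hV.2.2.2.1
      _ = gainLT n k W (z + 1) :=
          gainLE_eq_gainLT_of_agree (by omega) (fun y _ hy => hmin y (by omega)) hxV.1 hxV.2
      _ ≤ gainLT n k W j' := gainLT_monotone_of_majority hn (by omega) hxj hj' hW.2.2.2.1
      _ < gainLE n k W j' := hW.gainLT_lt_gainLE hn hj'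
  · -- `W` is a truncation of `V`; the last omitted block has positive gain
    obtain ⟨y, rfl⟩ : ∃ y, j = y + 1 := ⟨j - 1, by omega⟩
    have h4 := hW.four_le
    have h1 := gainLE_antitone_of_majority (k := k) (V := V) (a := j') (b := y) hn h4 (by omega)
      (by omega) fun i h h' => hV.2.2.2.1 i h (by omega)
    have h2 : gainLE n k V j' = gainLE n k W j' := gainLE_congr fun y _ hy => hmin y (by omega)
    have h3 := hV.prefixCard_end
    rw [prefixCard_succ_of_mem (by omega) hV.2.1] at h3
    have h5 : y + 1 < 2 * prefixCard V y := by
      rcases hV.2.2.2.2 with h | h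
      · have h6 := h.2
        rw [prefixCard_succ_of_mem (by omega) hV.2.1] at h6
        omega
      · omega
    have h6 := gain_pos hn hj h5 (hV.prefixCard_le y)
    rw [gainLE_succ_of_mem (by omega) (by omega) hV.2.1]
    omega

end ResistantWord

/-! ### The last resistant truncation minimizes the gain -/

/-- Once the elements of `U` make up exactly half of `[i]`, the remaining part of the block has
nonnegative gain. The two halves are proved together, as each refers to the other when the word
crosses the balanced line. -/
lemma gain_tail_of_balance {n k i : ℕ} {U : Finset ℕ} (hn : 2 * k < n) (hU : #U ≤ k)
    (hi : 1 ≤ i) (hin : i ≤ n) :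
    (i ≤ 2 * prefixCard U i → gainLT n k U i ≤ gainLE n k U n) ∧
    (2 * prefixCard U i ≤ i → gainLE n k U i ≤ gainLE n k U n) := by
  induction hin using Nat.decreasingInduction with
  | self =>
    refine ⟨fun h => ?_, fun _ => le_rfl⟩
    rw [gainLE_eq]
    have := gain_nonneg hn le_rfl h
    omega
  | of_succ i hin ih =>
    obtain ⟨ih1, ih2⟩ := ih (by omega)
    have hcard := (prefixCard_le_card U i).trans hU
    by_cases hmem : i + 1 ∈ U
    · have e1 := prefixCard_succ_of_mem hi hmem
      have e2 := gainLT_succ_of_mem (n := n) (k := k) hmem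
      have e3 := gainLE_succ_of_mem (k := k) hi hin hmem
      refine ⟨fun h => ?_, fun h => ?_⟩
      · rw [← e2]; exact ih1 (by omega)
      · rcases h.eq_or_lt with h | h
        · have e4 := ih1 (by omega)
          rw [e2] at e4
          have e5 := gain_nonpos hn hin.le h.le hcard
          rw [gainLE_eq]
          omega
        · have e4 := ih2 (by omega)
          have e5 := gain_nonpos (x := prefixCard U i) (i := i + 1) hn hin (by omega) hcard
          omega
    · have e1 := prefixCard_succ_of_notMem hmem
      have e2 := gainLT_succ_of_notMem (n := n) (k := k) hi hmem
      have e3 := gainLE_succ_of_notMem (k := k) hi hin hmem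
      refine ⟨fun h => ?_, fun h => ?_⟩
      · rcases h.eq_or_lt with h | h
        · have e4 := ih2 (by omega)
          rw [e3, gainLE_eq] at e4
          have e5 := gain_nonneg hn hin.le h.le
          omega
        · have e4 := ih1 (by omega)
          have e5 := gain_nonneg (x := prefixCard U i + 1) (i := i + 1) hn hin (by omega)
          omega
      · rw [← e3]; exact ih2 (by omega)

/-- If no truncation of `U` beyond `i` is resistant, the gain at `i` is at most the final gain. -/
lemma gainLE_le_of_no_resistant_truncation {n k i : ℕ} {U : Finset ℕ} (hn : 2 * k < n)
    (hU : #U ≤ k) (hi : 4 ≤ i) (hin : i ≤ n)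
    (hmaj : ∀ i', 4 ≤ i' → i' ≤ i → i' < 2 * prefixCard U i')
    (hres : ∀ t, i < t → t ≤ n → ¬ ResistantWord k (U ∩ Icc 2 t) t) :
    gainLE n k U i ≤ gainLE n k U n := by
  induction hin using Nat.decreasingInduction with
  | self => exact le_rfl
  | of_succ i hin ih =>
    have hcard := (prefixCard_le_card U i).trans hU
    have hi' := hmaj i hi le_rfl
    have ih' := fun h => ih (by omega) h fun t ht => hres t (by omega)
    have hstep : ∀ {c}, prefixCard U (i + 1) = c → i + 1 < 2 * c →
        ∀ i', 4 ≤ i' → i' ≤ i + 1 → i' < 2 * prefixCard U i' := by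
      intro c hc hc' i' h1 h2
      rcases h2.eq_or_lt with rfl | h2
      · omega
      · exact hmaj i' h1 (by omega)
    by_cases hmem : i + 1 ∈ U
    · have e1 := prefixCard_succ_of_mem (by omega) hmem
      have e3 := gainLE_succ_of_mem (k := k) (by omega) hin hmem
      have e4 := ih' (hstep e1 (by omega))
      -- otherwise the truncation at `i + 1` would be resistant
      have e5 : 2 * prefixCard U i ≤ i + 1 := by
        by_contra hcon
        refine hres (i + 1) (by omega) hin ⟨inter_subset_right, by simp [hmem]; omega,
          (card_le_card inter_subset_left).trans hU, ?_, Or.inl ⟨by omega, ?_⟩⟩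
        · intro i' h1 h2
          rw [prefixCard_congr (V := U) (by intro x hx hx'; simp; omega)]
          exact hmaj i' h1 (by omega)
        · rw [prefixCard_congr (V := U) (by intro x hx hx'; simp; omega)]
          omega
      have e6 := gain_nonpos (i := i + 1) hn hin e5 hcard
      omega
    · have e1 := prefixCard_succ_of_notMem hmem
      rw [← gainLE_succ_of_notMem (by omega) hin hmem]
      by_cases h : i + 1 < 2 * prefixCard U i
      · exact ih' (hstep e1 h)
      · exact (gain_tail_of_balance (i := i + 1) hn hU (by omega) hin).2 (by omega)

/-! ### Counting the families -/

lemma card_filter_inter_eq {n r t : ℕ} {X : Finset ℕ} (ht : 1 ≤ t) (htn : t ≤ n)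
    (hX : X ⊆ Icc 2 t) :
    (#{A ∈ powersetCard r (Icc 2 n) | A ∩ Icc 2 t = X} : ℤ) = blockCard n r #X t := by
  unfold blockCard
  split_ifs with h
  · have key : #{A ∈ powersetCard r (Icc 2 n) | A ∩ Icc 2 t = X} =
        #(powersetCard (r - #X) (Icc (t + 1) n)) := by
      refine card_nbij' (fun A => A \ X) (fun D => X ∪ D) ?_ ?_ ?_ ?_
      · intro A hA
        obtain ⟨hA', rfl⟩ := mem_filter.1 (mem_coe.1 hA)
        obtain ⟨h1, h2⟩ := mem_powersetCard.1 hA'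
        refine mem_coe.2 (mem_powersetCard.2 ⟨?_, ?_⟩)
        · intro x hx
          have := h1 (mem_sdiff.1 hx).1
          simp only [mem_sdiff, mem_inter, mem_Icc] at hx this ⊢
          grind
        · rw [card_sdiff_of_subset inter_subset_left, h2]
      · intro D hD
        have hD' := mem_powersetCard.1 (mem_coe.1 hD)
        refine mem_coe.2 (mem_filter.2 ⟨mem_powersetCard.2 ⟨?_, ?_⟩, ?_⟩)
        · refine union_subset (hX.trans (Icc_subset_Icc le_rfl htn))
            (hD'.1.trans (Icc_subset_Icc (by omega) le_rfl))
        · rw [card_union_of_disjoint, hD'.2, Nat.add_sub_cancel' h]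
          rw [disjoint_left]
          intro x hx hx'
          have := mem_Icc.1 (hX hx)
          have := mem_Icc.1 (hD'.1 hx')
          omega
        · ext x
          have h1 : x ∈ X → x ≤ t ∧ 2 ≤ x := fun hx => by have := mem_Icc.1 (hX hx); omega
          have h2 : x ∈ D → t < x := fun hx => by have := mem_Icc.1 (hD'.1 hx); omega
          simp only [mem_inter, mem_union, mem_Icc]
          grind
      · intro A hA
        obtain ⟨-, rfl⟩ := mem_filter.1 (mem_coe.1 hA)
        exact union_sdiff_of_subset inter_subset_left
      · intro D hD
        have hD' := mem_powersetCard.1 (mem_coe.1 hD)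
        refine union_sdiff_cancel_left ?_
        rw [disjoint_left]
        intro x hx hx'
        have := mem_Icc.1 (hX hx)
        have := mem_Icc.1 (hD'.1 hx')
        omega
    rw [key, card_powersetCard, Nat.card_Icc, Nat.add_sub_add_right]
  · rw [Nat.cast_eq_zero, card_eq_zero, filter_eq_empty_iff]
    rintro A hA rfl
    exact h ((card_le_card inter_subset_left).trans (mem_powersetCard.1 hA).2.le)

/-- The trace of `A` on `[2, i]` does not come after that of `U` in the lexicographical order. -/
def PrefixLE (A U : Finset ℕ) (i : ℕ) : Prop :=
  (∀ x, 2 ≤ x → x ≤ i → (x ∈ A ↔ x ∈ U)) ∨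
    ∃ t, 2 ≤ t ∧ t ≤ i ∧ t ∈ A ∧ t ∉ U ∧ ∀ x, 2 ≤ x → x < t → (x ∈ A ↔ x ∈ U)

lemma agree_or_exists_first_diff (A U : Finset ℕ) (i : ℕ) :
    (∀ x, 2 ≤ x → x ≤ i → (x ∈ A ↔ x ∈ U)) ∨
      ∃ t, 2 ≤ t ∧ t ≤ i ∧ ¬(t ∈ A ↔ t ∈ U) ∧ ∀ x, 2 ≤ x → x < t → (x ∈ A ↔ x ∈ U) := by
  classical
  by_cases h : ∃ t, 2 ≤ t ∧ t ≤ i ∧ ¬(t ∈ A ↔ t ∈ U)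
  · right
    obtain ⟨h1, h2, h3⟩ := Nat.find_spec h
    refine ⟨Nat.find h, h1, h2, h3, fun x hx hx' => ?_⟩
    have := Nat.find_min h hx'
    by_contra hcon
    exact this ⟨hx, by omega, hcon⟩
  · left
    push Not at h
    exact h

lemma not_prefixLE_of_first_diff {A U : Finset ℕ} {i t : ℕ} (h2 : 2 ≤ t) (hi : t ≤ i)
    (hA : t ∉ A) (hU : t ∈ U) (h : ∀ x, 2 ≤ x → x < t → (x ∈ A ↔ x ∈ U)) :
    ¬ PrefixLE A U i := by
  rintro (h' | ⟨s, hs2, hsi, hsA, hsU, hs⟩)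
  · exact hA ((h' t h2 hi).2 hU)
  · rcases lt_trichotomy s t with hst | rfl | hst
    · exact hsU ((h s hs2 hst).1 hsA)
    · exact hA hsA
    · exact hA ((hs t h2 hst).2 hU)

open Classical in
lemma card_filter_prefixLE {n r i : ℕ} (U : Finset ℕ) (hi : 1 ≤ i) (hin : i ≤ n) :
    (#{A ∈ powersetCard r (Icc 2 n) | PrefixLE A U i} : ℤ) = countLE n r U i := by
  set P := powersetCard r (Icc 2 n)
  let D : ℕ → Finset (Finset ℕ) := fun t =>
    {A ∈ P | A ∩ Icc 2 t = insert t (U ∩ Icc 2 (t - 1))}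
  have hD : ∀ t, 2 ≤ t → ∀ A, A ∈ D t ↔
      A ∈ P ∧ t ∈ A ∧ ∀ x, 2 ≤ x → x < t → (x ∈ A ↔ x ∈ U) := by
    intro t ht A
    simp only [D, mem_filter, Finset.ext_iff, mem_inter, mem_Icc, mem_insert]
    refine and_congr_right fun _ => ⟨fun h => ⟨by have := h t; grind, fun x hx hx' => ?_⟩, ?_⟩
    · have := h x; grind
    · rintro ⟨h1, h2⟩ x
      rcases eq_or_ne x t with rfl | hxt
      · simp [h1, ht]
      · have := h2 x; grind
  have hsplit : ({A ∈ P | PrefixLE A U i} : Finset (Finset ℕ)) =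
      (Icc 2 i \ U).biUnion D ∪ {A ∈ P | A ∩ Icc 2 i = U ∩ Icc 2 i} := by
    ext A
    have hE : A ∩ Icc 2 i = U ∩ Icc 2 i ↔ ∀ x, 2 ≤ x → x ≤ i → (x ∈ A ↔ x ∈ U) := by
      simp only [Finset.ext_iff, mem_inter, mem_Icc]; grind
    simp only [mem_union, mem_biUnion, mem_filter, hE, mem_sdiff, mem_Icc]
    constructor
    · rintro ⟨h, h' | ⟨t, h1, h2, h3, h4, h5⟩⟩
      · exact Or.inr ⟨h, h'⟩
      · exact Or.inl ⟨t, ⟨⟨h1, h2⟩, h4⟩, (hD t h1 A).2 ⟨h, h3, h5⟩⟩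
    · rintro (⟨t, ⟨⟨h1, h2⟩, h4⟩, h⟩ | ⟨h, h'⟩)
      · obtain ⟨h, h3, h5⟩ := (hD t h1 A).1 h
        exact ⟨h, Or.inr ⟨t, h1, h2, h3, h4, h5⟩⟩
      · exact ⟨h, Or.inl h'⟩
  rw [hsplit, card_union_of_disjoint, card_biUnion]
  · push_cast
    rw [countLE, countLT]
    congr 1
    · refine sum_congr rfl fun t ht => ?_
      simp only [mem_sdiff, mem_Icc] at ht
      have h1 : insert t (U ∩ Icc 2 (t - 1)) ⊆ Icc 2 t := by
        intro x hx
        simp only [mem_insert, mem_inter, mem_Icc] at hx ⊢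
        omega
      rw [card_filter_inter_eq (by omega) (by omega) h1, card_insert_of_notMem, prefixCard]
      simp only [mem_inter, not_and]
      exact fun h => absurd h ht.2
    · exact card_filter_inter_eq hi hin inter_subset_right
  · -- members of distinct blocks leave `U` at distinct places
    intro s hs t ht hst
    rw [Function.onFun, disjoint_left]
    intro A hAs hAt
    simp only [mem_coe, mem_sdiff, mem_Icc] at hs ht
    obtain ⟨-, h1, h2⟩ := (hD s hs.1.1 A).1 hAs
    obtain ⟨-, h3, h4⟩ := (hD t ht.1.1 A).1 hAt
    rcases lt_or_gt_of_ne hst with h | h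
    · exact hs.2 ((h4 s hs.1.1 h).1 h1)
    · exact ht.2 ((h2 t ht.1.1 h).1 h3)
  · rw [disjoint_left]
    intro A hA hA'
    obtain ⟨t, ht, hAt⟩ := mem_biUnion.1 hA
    simp only [mem_sdiff, mem_Icc] at ht
    have h1 := ((hD t ht.1.1 A).1 hAt).2.1
    have h2 : t ∈ U ∩ Icc 2 i := by
      rw [← (mem_filter.1 hA').2]
      exact mem_inter.2 ⟨h1, mem_Icc.2 ht.1⟩
    exact ht.2 (mem_inter.1 h2).1

/-- Complementation in `[2, n]` exchanges `(k - 1)`-sets and `(n - k)`-sets. -/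
lemma card_filter_compl {n k : ℕ} (hk : 1 ≤ k) (hn : k < n) (p : Finset ℕ → Prop)
    [DecidablePred p] :
    #{A ∈ powersetCard (k - 1) (Icc 2 n) | p (Icc 2 n \ A)} =
      #{Y ∈ powersetCard (n - k) (Icc 2 n) | p Y} := by
  refine card_nbij' (fun A => Icc 2 n \ A) (fun A => Icc 2 n \ A) ?_ ?_ ?_ ?_
  · intro A hA
    obtain ⟨h1, h2⟩ := mem_filter.1 (mem_coe.1 hA)
    obtain ⟨h1, h3⟩ := mem_powersetCard.1 h1
    refine mem_coe.2 (mem_filter.2 ⟨mem_powersetCard.2 ⟨sdiff_subset, ?_⟩, h2⟩)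
    rw [card_sdiff_of_subset h1, h3, Nat.card_Icc]; omega
  · intro A hA
    obtain ⟨h1, h2⟩ := mem_filter.1 (mem_coe.1 hA)
    obtain ⟨h1, h3⟩ := mem_powersetCard.1 h1
    refine mem_coe.2 (mem_filter.2 ⟨mem_powersetCard.2 ⟨sdiff_subset, ?_⟩, ?_⟩)
    · rw [card_sdiff_of_subset h1, h3, Nat.card_Icc]; omega
    · rwa [Finset.sdiff_sdiff_eq_self h1]
  · intro A hA
    exact Finset.sdiff_sdiff_eq_self (mem_powersetCard.1 (mem_filter.1 (mem_coe.1 hA)).1).1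
  · intro A hA
    exact Finset.sdiff_sdiff_eq_self (mem_powersetCard.1 (mem_filter.1 (mem_coe.1 hA)).1).1

lemma lexLE_iff_prefixLE {n j : ℕ} {A T : Finset ℕ} (hT : T ⊆ Icc 2 j) (hA : A ⊆ Icc 2 n) :
    LexLE A T ↔ PrefixLE A T j := by
  have hA2 : ∀ x ∈ A, 2 ≤ x := fun x hx => (mem_Icc.1 (hA hx)).1
  have hT2 : ∀ x ∈ T, 2 ≤ x ∧ x ≤ j := fun x hx => mem_Icc.1 (hT hx)
  constructor
  · intro h
    rcases agree_or_exists_first_diff A T j with h' | ⟨t, h2, hj, hne, hag⟩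
    · exact Or.inl h'
    · by_cases htA : t ∈ A
      · exact Or.inr ⟨t, h2, hj, htA, by tauto, hag⟩
      · have htT : t ∈ T := by tauto
        rcases h with h | ⟨a, ha, hab⟩
        · exact absurd (h htT) htA
        · have h1 := hab t (mem_sdiff.2 ⟨htT, htA⟩)
          rw [mem_sdiff] at ha
          have := hag a (hA2 a ha.1) h1
          tauto
  · rintro (h | ⟨t, h2, hj, htA, htT, hag⟩)
    · exact Or.inl fun x hx => (h x (hT2 x hx).1 (hT2 x hx).2).2 hx
    · refine Or.inr ⟨t, mem_sdiff.2 ⟨htA, htT⟩, fun b hb => ?_⟩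
      rw [mem_sdiff] at hb
      by_contra hcon
      rcases (not_lt.1 hcon).eq_or_lt with rfl | hlt
      · exact htT hb.1
      · exact hb.2 ((hag b (hT2 b hb.1).1 hlt).2 hb.1)

/-- If `S` and `T` meet only in `j` and cover `[j]`, then the members of `𝓛(S, ·)` are exactly the
sets whose complement comes after `T`. -/
lemma not_lexLE_iff_prefixLE_compl {n j : ℕ} {A S T : Finset ℕ} (hj : 2 ≤ j) (hjn : j ≤ n)
    (hA : A ⊆ Icc 2 n) (hinter : S ∩ T = {j}) (hunion : S ∪ T = Icc 1 j) :
    ¬ LexLE A (S ∩ Icc 2 n) ↔ PrefixLE (Icc 2 n \ A) T j := by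
  have hi : ∀ x, (x ∈ S ∧ x ∈ T ↔ x = j) := fun x => by
    rw [← mem_inter, hinter, mem_singleton]
  have hu : ∀ x, (x ∈ S ∨ x ∈ T ↔ 1 ≤ x ∧ x ≤ j) := fun x => by
    rw [← mem_union, hunion, mem_Icc]
  have hA2 : ∀ x ∈ A, 2 ≤ x ∧ x ≤ n := fun x hx => mem_Icc.1 (hA hx)
  have hS : ∀ x, x ∈ S ∩ Icc 2 n ↔ x ∈ S ∧ 2 ≤ x := fun x => by
    have := hu x
    simp only [mem_inter, mem_Icc]; grind
  have hY : ∀ x, 2 ≤ x → x ≤ j → (x ∈ Icc 2 n \ A ↔ x ∉ A) := fun x h1 h2 => by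
    simp only [mem_sdiff, mem_Icc]; grind
  -- below `j`, membership in `S` is the negation of membership in `T`
  have hST : ∀ x, 2 ≤ x → x < j → (x ∈ S ↔ x ∉ T) := fun x h1 h2 => by
    have := hu x
    have := hi x
    grind
  have hjS := ((hi j).2 rfl).1
  have hjT := ((hi j).2 rfl).2
  rcases agree_or_exists_first_diff (Icc 2 n \ A) T j with h | ⟨t, h2, htj, hne, hag⟩
  · refine iff_of_true ?_ (Or.inl h)
    have hjA : j ∉ A := (hY j hj le_rfl).1 ((h j hj le_rfl).2 hjT)
    rintro (h' | ⟨a, ha, hab⟩)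
    · exact hjA (h' ((hS j).2 ⟨hjS, hj⟩))
    · have h1 := hab j (mem_sdiff.2 ⟨(hS j).2 ⟨hjS, hj⟩, hjA⟩)
      rw [mem_sdiff, hS] at ha
      have h2 := (hA2 a ha.1).1
      have h3 := h a h2 h1.le
      rw [hY a h2 h1.le] at h3
      have := hST a h2 h1
      tauto
  · have hag' : ∀ x, 2 ≤ x → x < t → (x ∈ A ↔ x ∈ S) := fun x h1 h3 => by
      have h4 := hag x h1 h3
      rw [hY x h1 (by omega)] at h4
      have := hST x h1 (by omega)
      tauto
    rw [hY t h2 htj] at hne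
    by_cases htT : t ∈ T
    · have htA : t ∈ A := by tauto
      refine iff_of_false (not_not.2 ?_) ?_
      · rcases htj.eq_or_lt with rfl | htj
        · left
          intro x hx
          rw [hS] at hx
          rcases ((hu x).1 (Or.inl hx.1)).2.eq_or_lt with rfl | h3
          · exact htA
          · exact (hag' x hx.2 h3).2 hx.1
        · have htS : t ∉ S := fun h => (hST t h2 htj).1 h htT
          refine Or.inr ⟨t, mem_sdiff.2 ⟨htA, fun h => htS ((hS t).1 h).1⟩, fun b hb => ?_⟩
          rw [mem_sdiff, hS] at hb
          by_contra hcon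
          rcases (not_lt.1 hcon).eq_or_lt with rfl | hlt
          · exact hb.2 htA
          · exact hb.2 ((hag' b hb.1.2 hlt).2 hb.1.1)
      · exact not_prefixLE_of_first_diff h2 htj (by rw [hY t h2 htj]; tauto) htT hag
    · have htA : t ∉ A := by tauto
      have htj' : t < j := lt_of_le_of_ne htj fun h => htT (h ▸ hjT)
      have htS : t ∈ S := (hST t h2 htj').2 htT
      refine iff_of_true ?_ (Or.inr ⟨t, h2, htj, (hY t h2 htj).2 htA, htT, hag⟩)
      rintro (h' | ⟨a, ha, hab⟩)
      · exact htA (h' ((hS t).2 ⟨htS, h2⟩))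
      · have h1 := hab t (mem_sdiff.2 ⟨(hS t).2 ⟨htS, h2⟩, htA⟩)
        rw [mem_sdiff, hS] at ha
        have h3 := (hA2 a ha.1).1
        have := hag' a h3 h1
        tauto

lemma card_lexFamily_eq_countLE {n r j : ℕ} {T : Finset ℕ} (hj : 1 ≤ j) (hjn : j ≤ n)
    (hT : T ⊆ Icc 2 j) : (#(lexFamily n T r) : ℤ) = countLE n r T j := by
  classical
  have hTn : T ∩ Icc 2 n = T := inter_eq_left.2 (hT.trans (Icc_subset_Icc le_rfl hjn))
  rw [← card_filter_prefixLE T hj hjn, lexFamily, hTn]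
  congr 2
  refine filter_congr fun A hA => lexLE_iff_prefixLE hT (mem_powersetCard.1 hA).1

lemma card_lexFamily_partner {n k j : ℕ} {S T : Finset ℕ} (hk : 1 ≤ k) (hn : k < n)
    (hj : 2 ≤ j) (hjn : j ≤ n) (hinter : S ∩ T = {j}) (hunion : S ∪ T = Icc 1 j) :
    (#(lexFamily n S (k - 1)) : ℤ) = (n - 1).choose (k - 1) - countLE n (n - k) T j := by
  classical
  have h1 := card_filter_add_card_filter_not (s := powersetCard (k - 1) (Icc 2 n))
    fun A => LexLE A (S ∩ Icc 2 n)
  have h2 : #{A ∈ powersetCard (k - 1) (Icc 2 n) | ¬ LexLE A (S ∩ Icc 2 n)} =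
      #{Y ∈ powersetCard (n - k) (Icc 2 n) | PrefixLE Y T j} := by
    rw [← card_filter_compl hk hn]
    congr 1
    exact filter_congr fun A hA =>
      not_lexLE_iff_prefixLE_compl hj hjn (mem_powersetCard.1 hA).1 hinter hunion
  rw [card_powersetCard, Nat.card_Icc, show n + 1 - 2 = n - 1 by omega, h2] at h1
  rw [← card_filter_prefixLE T (by omega) hjn, ← h1, lexFamily]
  push_cast
  ring

/-! ### Cross-intersecting families and the Kruskal-Katona theorem -/

/-- A set that does not come after `U` contains a `k`-set that does not come after `U`. -/
lemma PrefixLE.exists_subset {n k : ℕ} {Y U : Finset ℕ} (h : PrefixLE Y U n)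
    (hU : U ⊆ Icc 2 n) (hUk : #U = k) (hYk : k ≤ #Y) :
    ∃ Z ⊆ Y, #Z = k ∧ PrefixLE Z U n := by
  by_cases hUY : U ⊆ Y
  · exact ⟨U, hUY, hUk, Or.inl fun _ _ _ => Iff.rfl⟩
  obtain ⟨y, hyU, hyY⟩ := not_subset.1 hUY
  have hy := mem_Icc.1 (hU hyU)
  rcases h with h | ⟨t, h2, htn, htY, htU, hag⟩
  · exact absurd ((h y hy.1 hy.2).2 hyU) hyY
  · have hty : t < y := by
      by_contra hcon
      rcases (not_lt.1 hcon).eq_or_lt with rfl | hlt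
      · exact htU hyU
      · exact hyY ((hag y hy.1 hlt).2 hyU)
    have hsub : Y ∩ Icc 2 t ⊆ insert t (U.erase y) := by
      intro x hx
      rw [mem_inter, mem_Icc] at hx
      rcases hx.2.2.eq_or_lt with rfl | hlt
      · exact mem_insert_self _ _
      · exact mem_insert_of_mem
          (mem_erase.2 ⟨by omega, (hag x hx.2.1 hlt).1 hx.1⟩)
    have hcard : #(Y ∩ Icc 2 t) ≤ k := by
      refine (card_le_card hsub).trans ((card_insert_le _ _).trans ?_)
      rw [card_erase_add_one hyU, hUk]
    obtain ⟨Z, h1, h3, h4⟩ := exists_subsuperset_card_eq inter_subset_left hcard hYk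
    refine ⟨Z, h3, h4, Or.inr ⟨t, h2, htn, h1 (mem_inter.2 ⟨htY, mem_Icc.2 ⟨h2, le_rfl⟩⟩), htU,
      fun x hx hx' => ⟨fun h => (hag x hx hx').1 (h3 h), fun h => h1 ?_⟩⟩⟩
    exact mem_inter.2 ⟨(hag x hx hx').2 h, mem_Icc.2 ⟨hx, hx'.le⟩⟩

lemma exists_card_filter_le_eq {α : Type*} [LinearOrder α] (s : Finset α) {b : ℕ} (hb : 0 < b)
    (hbs : b ≤ #s) : ∃ u ∈ s, #{x ∈ s | x ≤ u} = b := by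
  induction s using Finset.induction_on_max with
  | empty => simp at hbs; omega
  | insert a s hlt ih =>
    have ha : a ∉ s := fun h => lt_irrefl _ (hlt a h)
    rw [card_insert_of_notMem ha] at hbs
    rcases hbs.eq_or_lt with rfl | hbs
    · refine ⟨a, mem_insert_self _ _, ?_⟩
      rw [filter_true_of_mem, card_insert_of_notMem ha]
      intro x hx
      rcases mem_insert.1 hx with rfl | hx
      · exact le_rfl
      · exact (hlt x hx).le
    · obtain ⟨u, hu, hcard⟩ := ih (by omega)
      refine ⟨u, mem_insert_of_mem hu, ?_⟩
      rw [filter_insert, if_neg (not_le.2 (hlt u hu)), hcard]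

/-- The reflection of the complement of `A` in `[2, n]`, as a subset of `{0, …, n - 2}`: it contains
`x` iff `n - x ∉ A`. It turns the lexicographical order into the colexicographical one. -/
def reflectCompl (n : ℕ) (A : Finset ℕ) : Finset (Fin (n - 1)) :=
  {x | n - (x : ℕ) ∉ A}

lemma mem_reflectCompl {n : ℕ} {A : Finset ℕ} {x : Fin (n - 1)} :
    x ∈ reflectCompl n A ↔ n - (x : ℕ) ∉ A := by
  simp [reflectCompl]

lemma exists_fin_sub_eq {n y : ℕ} (h : y ∈ Icc 2 n) : ∃ x : Fin (n - 1), n - (x : ℕ) = y := by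
  rw [mem_Icc] at h
  exact ⟨⟨n - y, by omega⟩, by simp only; omega⟩

lemma sub_fin_mem_Icc {n : ℕ} (x : Fin (n - 1)) : n - (x : ℕ) ∈ Icc 2 n := by
  have := x.2
  rw [mem_Icc]; omega

lemma reflectCompl_subset_iff {n : ℕ} {A B : Finset ℕ} (hA : A ⊆ Icc 2 n) :
    reflectCompl n B ⊆ reflectCompl n A ↔ A ⊆ B := by
  constructor
  · intro h y hy
    obtain ⟨x, rfl⟩ := exists_fin_sub_eq (hA hy)
    by_contra hcon
    exact mem_reflectCompl.1 (h (mem_reflectCompl.2 hcon)) hy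
  · intro h x hx
    exact mem_reflectCompl.2 fun hx' => mem_reflectCompl.1 hx (h hx')

lemma reflectCompl_injOn (n : ℕ) {s : Set (Finset ℕ)} (hs : ∀ A ∈ s, A ⊆ Icc 2 n) :
    Set.InjOn (reflectCompl n) s := fun A hA B hB h =>
  ((reflectCompl_subset_iff (hs A hA)).1 h.ge).antisymm
    ((reflectCompl_subset_iff (hs B hB)).1 h.le)

lemma card_reflectCompl {n : ℕ} {A : Finset ℕ} (hA : A ⊆ Icc 2 n) :
    #(reflectCompl n A) = n - 1 - #A := by
  have h1 : #(reflectCompl n A) = #(Icc 2 n \ A) := by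
    refine card_bij (fun x _ => n - (x : ℕ)) ?_ ?_ ?_
    · intro x hx
      exact mem_sdiff.2 ⟨sub_fin_mem_Icc x, mem_reflectCompl.1 hx⟩
    · intro x _ y _ h
      have := x.2
      have := y.2
      exact Fin.ext (by omega)
    · intro y hy
      obtain ⟨x, rfl⟩ := exists_fin_sub_eq (mem_sdiff.1 hy).1
      exact ⟨x, mem_reflectCompl.2 (mem_sdiff.1 hy).2, rfl⟩
  rw [h1, card_sdiff_of_subset hA, Nat.card_Icc]
  omega

lemma exists_reflectCompl_eq {n : ℕ} (s : Finset (Fin (n - 1))) :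
    ∃ A ⊆ Icc 2 n, reflectCompl n A = s := by
  refine ⟨sᶜ.image fun x : Fin (n - 1) => n - (x : ℕ), ?_, ?_⟩
  · intro y hy
    obtain ⟨x, -, rfl⟩ := mem_image.1 hy
    exact sub_fin_mem_Icc x
  · ext x
    rw [mem_reflectCompl, mem_image]
    constructor
    · intro h
      by_contra hcon
      exact h ⟨x, mem_compl.2 hcon, rfl⟩
    · rintro h ⟨y, hy, hxy⟩
      have := x.2
      have := y.2
      have : y = x := Fin.ext (by omega)
      exact mem_compl.1 hy (this ▸ h)

lemma toColex_reflectCompl_le_iff {n : ℕ} {A U : Finset ℕ} :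
    toColex (reflectCompl n A) ≤ toColex (reflectCompl n U) ↔ PrefixLE A U n := by
  rw [Colex.toColex_le_toColex]
  simp only [mem_reflectCompl, not_not]
  constructor
  · intro h
    rcases agree_or_exists_first_diff A U n with h' | ⟨t, h2, htn, hne, hag⟩
    · exact Or.inl h'
    · by_cases htA : t ∈ A
      · exact Or.inr ⟨t, h2, htn, htA, by tauto, hag⟩
      · obtain ⟨x, rfl⟩ := exists_fin_sub_eq (mem_Icc.2 ⟨h2, htn⟩)
        obtain ⟨b, hb1, hb2, hb3⟩ := h htA (by tauto)
        have hb := mem_Icc.1 (sub_fin_mem_Icc b)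
        rcases hb3.eq_or_lt with rfl | hlt
        · tauto
        · have h4 : (x : ℕ) < b := hlt
          have := hag (n - b) hb.1 (by omega)
          tauto
  · intro h a ha haU
    by_contra hcon
    push Not at hcon
    have hle := mem_Icc.1 (sub_fin_mem_Icc a)
    rcases h with h | ⟨t, h2, htn, htA, htU, hag⟩
    · exact ha ((h _ hle.1 hle.2).2 haU)
    · obtain ⟨x, rfl⟩ := exists_fin_sub_eq (mem_Icc.2 ⟨h2, htn⟩)
      have h4 : (x : ℕ) < a := hcon x htU htA
      have hx := x.2
      have ha' := a.2
      exact ha ((hag _ hle.1 (by omega)).2 haU)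

/-- Among all cross-intersecting pairs with a given number of `k`-sets, an initial segment of the
lexicographical order leaves room for the largest number of `(k - 1)`-sets. -/
lemma CrossIntersecting.exists_countLE {n k : ℕ} (hk : 1 ≤ k) (hn : 2 * k < n)
    {𝒜 ℬ : Finset (Finset ℕ)} (h𝒜 : 𝒜 ⊆ powersetCard (k - 1) (Icc 2 n))
    (hℬ : ℬ ⊆ powersetCard k (Icc 2 n)) (hcross : CrossIntersecting 𝒜 ℬ) (hne : ℬ.Nonempty) :
    ∃ U ∈ powersetCard k (Icc 2 n), (#ℬ : ℤ) = countLE n k U n ∧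
      (#𝒜 : ℤ) ≤ (n - 1).choose (k - 1) - countLE n (n - k) U n := by
  classical
  have hℬ' : ∀ B ∈ ℬ, B ⊆ Icc 2 n ∧ #B = k := fun B hB => mem_powersetCard.1 (hℬ hB)
  have h𝒜' : ∀ A ∈ 𝒜, A ⊆ Icc 2 n ∧ #A = k - 1 := fun A hA => mem_powersetCard.1 (h𝒜 hA)
  set 𝒟 := ℬ.image (reflectCompl n) with h𝒟
  have h𝒟card : #𝒟 = #ℬ := card_image_of_injOn (reflectCompl_injOn n fun B hB => (hℬ' B hB).1)
  have h𝒟sized : (𝒟 : Set (Finset (Fin (n - 1)))).Sized (n - 1 - k) := by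
    intro s hs
    obtain ⟨B, hB, rfl⟩ := mem_image.1 (mem_coe.1 hs)
    rw [card_reflectCompl (hℬ' B hB).1, (hℬ' B hB).2]
  -- the initial segment of the colexicographical order of the same size
  obtain ⟨u, hu, hucard⟩ : ∃ u : Finset (Fin (n - 1)), #u = n - 1 - k ∧
      #(Colex.initSeg u) = #ℬ := by
    obtain ⟨v, hv, hvcard⟩ := exists_card_filter_le_eq
      ((powersetCard (n - 1 - k) (univ : Finset (Fin (n - 1)))).map toColex.toEmbedding)
      (card_pos.2 hne) (by
        rw [card_map, ← h𝒟card]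
        exact card_le_card fun s hs => mem_powersetCard.2 ⟨subset_univ _, h𝒟sized hs⟩)
    obtain ⟨u, hu, rfl⟩ := mem_map.1 hv
    have hu' := (mem_powersetCard.1 hu).2
    refine ⟨u, hu', ?_⟩
    rw [← hvcard, filter_map, card_map]
    congr 1
    ext t
    simp [hu', eq_comm]
  obtain ⟨U, hUsub, rfl⟩ := exists_reflectCompl_eq u
  have hUk : #U = k := by
    have h1 := card_le_card hUsub
    rw [card_reflectCompl hUsub] at hu
    rw [Nat.card_Icc] at h1
    omega
  refine ⟨U, mem_powersetCard.2 ⟨hUsub, hUk⟩, ?_, ?_⟩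
  · rw [← card_filter_prefixLE U (by omega) le_rfl, ← hucard, Nat.cast_inj]
    symm
    refine card_nbij (reflectCompl n) ?_ ?_ ?_
    · intro Z hZ
      obtain ⟨h1, h2⟩ := mem_filter.1 (mem_coe.1 hZ)
      obtain ⟨h1, h3⟩ := mem_powersetCard.1 h1
      refine mem_coe.2 (Colex.mem_initSeg.2 ⟨?_, toColex_reflectCompl_le_iff.2 h2⟩)
      rw [hu, card_reflectCompl h1, h3]
    · exact reflectCompl_injOn n fun Z hZ =>
        (mem_powersetCard.1 (mem_filter.1 (mem_coe.1 hZ)).1).1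
    · intro s hs
      obtain ⟨Z, hZ, rfl⟩ := exists_reflectCompl_eq s
      obtain ⟨h1, h2⟩ := Colex.mem_initSeg.1 (mem_coe.1 hs)
      refine ⟨Z, mem_coe.2 (mem_filter.2 ⟨mem_powersetCard.2 ⟨hZ, ?_⟩,
        toColex_reflectCompl_le_iff.1 h2⟩), rfl⟩
      have h3 := card_le_card hZ
      rw [hu, card_reflectCompl hZ] at h1
      rw [Nat.card_Icc] at h3
      omega
  · have hKK : #(shadow^[n - 2 * k] (Colex.initSeg (reflectCompl n U))) ≤
        #(shadow^[n - 2 * k] 𝒟) :=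
      iterated_kk h𝒟sized (by rw [hucard, h𝒟card]) (hu ▸ Colex.isInitSeg_initSeg)
    have hlower : #{Y ∈ powersetCard (n - k) (Icc 2 n) | PrefixLE Y U n} ≤
        #(shadow^[n - 2 * k] (Colex.initSeg (reflectCompl n U))) := by
      refine card_le_card_of_injOn (reflectCompl n) ?_ (reflectCompl_injOn n fun Z hZ =>
        (mem_powersetCard.1 (mem_filter.1 (mem_coe.1 hZ)).1).1)
      intro Y hY
      obtain ⟨h1, h2⟩ := mem_filter.1 (mem_coe.1 hY)
      obtain ⟨h1, h3⟩ := mem_powersetCard.1 h1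
      obtain ⟨Z, hZY, hZk, hZ⟩ := h2.exists_subset hUsub hUk (by omega)
      have hsub := (reflectCompl_subset_iff (hZY.trans h1)).2 hZY
      refine mem_coe.2 (mem_shadow_iterate_iff_exists_sdiff.2 ⟨reflectCompl n Z,
        Colex.mem_initSeg.2 ⟨?_, toColex_reflectCompl_le_iff.2 hZ⟩, hsub, ?_⟩)
      · rw [hu, card_reflectCompl (hZY.trans h1), hZk]
      · rw [card_sdiff_of_subset hsub, card_reflectCompl h1, card_reflectCompl (hZY.trans h1),
          h3, hZk]
        omega
    -- the complements of the members of `𝒜` cannot contain a member of `ℬ`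
    set 𝒜c := 𝒜.image fun A => reflectCompl n (Icc 2 n \ A) with h𝒜c
    have h𝒜card : #𝒜c = #𝒜 := by
      refine card_image_of_injOn fun A hA A' hA' h => ?_
      have h1 := reflectCompl_injOn n (s := {Z | Z ⊆ Icc 2 n}) (fun _ h => h)
        (sdiff_subset (t := A)) (sdiff_subset (t := A')) h
      rw [← Finset.sdiff_sdiff_eq_self (h𝒜' A hA).1, h1, Finset.sdiff_sdiff_eq_self (h𝒜' A' hA').1]
    have hdisj : Disjoint 𝒜c (shadow^[n - 2 * k] 𝒟) := by
      rw [disjoint_left]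
      intro s hs hs'
      obtain ⟨A, hA, rfl⟩ := mem_image.1 hs
      obtain ⟨t, ht, hst, -⟩ := mem_shadow_iterate_iff_exists_sdiff.1 hs'
      obtain ⟨B, hB, rfl⟩ := mem_image.1 ht
      have h1 := (reflectCompl_subset_iff (hℬ' B hB).1).1 hst
      obtain ⟨x, hx⟩ := hcross A hA B hB
      rw [mem_inter] at hx
      exact (mem_sdiff.1 (h1 hx.2)).2 hx.1
    have hall : 𝒜c ∪ shadow^[n - 2 * k] 𝒟 ⊆
        powersetCard (k - 1) (univ : Finset (Fin (n - 1))) := by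
      intro s hs
      refine mem_powersetCard.2 ⟨subset_univ _, ?_⟩
      rcases mem_union.1 hs with hs | hs
      · obtain ⟨A, hA, rfl⟩ := mem_image.1 hs
        rw [card_reflectCompl sdiff_subset, card_sdiff_of_subset (h𝒜' A hA).1, (h𝒜' A hA).2,
          Nat.card_Icc]
        omega
      · rw [h𝒟sized.shadow_iterate hs]
        omega
    have hfinal := card_le_card hall
    rw [card_union_of_disjoint hdisj, h𝒜card, card_powersetCard, card_univ, Fintype.card_fin]
      at hfinal
    rw [← card_filter_prefixLE U (by omega) le_rfl]
    have : #𝒜 + #{Y ∈ powersetCard (n - k) (Icc 2 n) | PrefixLE Y U n} ≤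
        (n - 1).choose (k - 1) := by omega
    have h := (Nat.cast_le (α := ℤ)).2 this
    push_cast at h
    linarith

/-! ### The lexicographical order and the enumeration of resistant pairs -/

lemma lexLT_iff {A B : Finset ℕ} :
    LexLT A B ↔ ∃ t, t ∈ A ∧ t ∉ B ∧ ∀ x < t, (x ∈ A ↔ x ∈ B) := by
  classical
  constructor
  · rintro ⟨hle, hne⟩
    have hex : ∃ x, ¬ (x ∈ A ↔ x ∈ B) := by
      by_contra hcon
      push Not at hcon
      exact hne (ext hcon)
    have h1 := Nat.find_spec hex
    have h2 : ∀ y < Nat.find hex, (y ∈ A ↔ y ∈ B) := fun y hy => not_not.1 (Nat.find_min hex hy)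
    generalize Nat.find hex = t at h1 h2
    refine ⟨t, ?_⟩
    suffices t ∈ A by tauto
    by_contra htA
    have htB : t ∈ B := by tauto
    rcases hle with h | ⟨a, ha, hab⟩
    · exact htA (h htB)
    · rw [mem_sdiff] at ha
      have := h2 a (hab t (mem_sdiff.2 ⟨htB, htA⟩))
      tauto
  · rintro ⟨t, htA, htB, h⟩
    refine ⟨Or.inr ⟨t, mem_sdiff.2 ⟨htA, htB⟩, fun b hb => ?_⟩, fun h => htB (h ▸ htA)⟩
    rw [mem_sdiff] at hb
    by_contra hcon
    rcases (not_lt.1 hcon).eq_or_lt with rfl | hlt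
    · exact htB hb.1
    · exact hb.2 ((h b hlt).2 hb.1)

lemma lexLE_iff_eq_or_lexLT {A B : Finset ℕ} : LexLE A B ↔ A = B ∨ LexLT A B := by
  constructor
  · intro h
    by_cases hAB : A = B
    · exact Or.inl hAB
    · exact Or.inr ⟨h, hAB⟩
  · rintro (rfl | h)
    · exact Or.inl Subset.rfl
    · exact h.1

lemma LexLT.trans {A B C : Finset ℕ} (h : LexLT A B) (h' : LexLT B C) : LexLT A C := by
  rw [lexLT_iff] at *
  obtain ⟨s, hs1, hs2, hs3⟩ := h
  obtain ⟨t, ht1, ht2, ht3⟩ := h'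
  rcases lt_trichotomy s t with hst | rfl | hst
  · exact ⟨s, hs1, fun h => hs2 ((ht3 s hst).2 h), fun x hx =>
      (hs3 x hx).trans (ht3 x (hx.trans hst))⟩
  · exact absurd ht1 hs2
  · exact ⟨t, (hs3 t hst).2 ht1, ht2, fun x hx => (hs3 x (hx.trans hst)).trans (ht3 x hx)⟩

lemma LexLT.not_lexLE {A B : Finset ℕ} (h : LexLT A B) : ¬ LexLE B A := by
  intro h'
  rcases lexLE_iff_eq_or_lexLT.1 h' with rfl | h'
  · exact h.2 rfl
  · exact (h.trans h').2 rfl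

lemma LexLT.trans_le {A B C : Finset ℕ} (h : LexLT A B) (h' : LexLE B C) : LexLT A C := by
  rcases lexLE_iff_eq_or_lexLT.1 h' with rfl | h'
  · exact h
  · exact h.trans h'

lemma LexLE.trans {A B C : Finset ℕ} (h : LexLE A B) (h' : LexLE B C) : LexLE A C := by
  rcases lexLE_iff_eq_or_lexLT.1 h with rfl | h
  · exact h'
  · exact (h.trans_le h').1

lemma lexLE_or_lexLT (A B : Finset ℕ) : LexLE A B ∨ LexLT B A := by
  classical
  by_cases hAB : A = B
  · exact Or.inl (Or.inl hAB.ge)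
  · have hex : ∃ x, ¬ (x ∈ A ↔ x ∈ B) := by
      by_contra hcon
      push Not at hcon
      exact hAB (ext hcon)
    have h1 := Nat.find_spec hex
    have h2 : ∀ y < Nat.find hex, (y ∈ A ↔ y ∈ B) := fun y hy => not_not.1 (Nat.find_min hex hy)
    by_cases h : Nat.find hex ∈ A
    · exact Or.inl (lexLT_iff.2 ⟨_, h, by tauto, h2⟩).1
    · exact Or.inr (lexLT_iff.2 ⟨_, by tauto, h, fun x hx => (h2 x hx).symm⟩)

lemma lexFamily_subset {n r : ℕ} {X Y : Finset ℕ} (hX : X ⊆ Icc 2 n) (hY : Y ⊆ Icc 2 n)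
    (h : LexLE X Y) : lexFamily n X r ⊆ lexFamily n Y r := by
  classical
  intro A hA
  rw [lexFamily, mem_filter] at hA ⊢
  rw [inter_eq_left.2 hX] at hA
  rw [inter_eq_left.2 hY]
  exact ⟨hA.1, hA.2.trans h⟩

lemma card_lexFamily_lt {n r : ℕ} {X U : Finset ℕ} (hX : X ⊆ Icc 2 n) (hU : U ⊆ Icc 2 n)
    (hr : #U = r) (h : LexLT X U) : #(lexFamily n X r) < #(lexFamily n U r) := by
  classical
  refine card_lt_card (ssubset_iff_of_subset (lexFamily_subset hX hU h.1) |>.2 ⟨U, ?_, ?_⟩)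
  · rw [lexFamily, mem_filter, inter_eq_left.2 hU]
    exact ⟨mem_powersetCard.2 ⟨hU, hr⟩, Or.inl Subset.rfl⟩
  · rw [lexFamily, mem_filter, inter_eq_left.2 hX]
    exact fun h' => h.not_lexLE h'.2

/-- If `S` and `T` meet only in `j` and cover `[j]`, the elements of `[i]` outside `S` are those of
`T`, except that `j` itself also lies in `S`. -/
lemma card_Icc_sdiff_eq {j i : ℕ} {S T : Finset ℕ} (hT : T ⊆ Icc 2 j) (hinter : S ∩ T = {j})
    (hunion : S ∪ T = Icc 1 j) (hi : i ≤ j) :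
    #(Icc 1 i \ S) = #((T ∩ Icc 2 i).erase j) := by
  congr 1
  ext x
  have h1 : (x ∈ S ∧ x ∈ T ↔ x = j) := by rw [← mem_inter, hinter, mem_singleton]
  have h2 : (x ∈ S ∨ x ∈ T ↔ 1 ≤ x ∧ x ≤ j) := by rw [← mem_union, hunion, mem_Icc]
  have h3 : x ∈ T → 2 ≤ x ∧ x ≤ j := fun hx => mem_Icc.1 (hT hx)
  simp only [mem_sdiff, mem_Icc, mem_erase, mem_inter]
  grind

/-- The majority condition on `S` expressed through the number of elements of `T` in `[2, i]`. -/
lemma card_inter_lt_card_sdiff_iff {j i : ℕ} {S T : Finset ℕ} (hT : T ⊆ Icc 2 j)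
    (hinter : S ∩ T = {j}) (hunion : S ∪ T = Icc 1 j) (hi : i ≤ j) :
    #(Icc 1 i ∩ S) < #(Icc 1 i \ S) ↔
      if i < j then i < 2 * prefixCard T i else j + 3 ≤ 2 * prefixCard T j := by
  have h1 := card_inter_add_card_sdiff (Icc 1 i) S
  have h2 := card_Icc_sdiff_eq hT hinter hunion hi
  have h3 : j ∈ T := (mem_inter.1 (hinter ▸ mem_singleton_self j)).2
  have h4 := mem_Icc.1 (hT h3)
  rw [Nat.card_Icc] at h1
  split_ifs with hij
  · rw [erase_eq_of_notMem (by simp; omega)] at h2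
    unfold prefixCard
    omega
  · obtain rfl : i = j := by omega
    have h5 : i ∈ T ∩ Icc 2 i := mem_inter.2 ⟨h3, mem_Icc.2 h4⟩
    have h6 := card_erase_add_one h5
    unfold prefixCard
    omega

lemma prefixCard_self_le (T : Finset ℕ) (j : ℕ) : prefixCard T j ≤ j - 1 := by
  have := card_le_card (inter_subset_right (s₁ := T) (s₂ := Icc 2 j))
  rw [Nat.card_Icc] at this
  unfold prefixCard
  omega

lemma IsResistantPair.exists_resistantWord {n k : ℕ} {S T : Finset ℕ} (hk : 3 ≤ k)
    (hn : 2 * k < n) (h : IsResistantPair n k S T) :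
    ∃ j ≤ n, ResistantWord k T j ∧ S ∩ T = {j} ∧ S ∪ T = Icc 1 j := by
  obtain ⟨-, hTn, ⟨j, hj4, hj, hinter, hunion, -, hTk, hmaj⟩ | ⟨rfl, rfl⟩⟩ := h
  · have hT : T ⊆ Icc 2 j := fun x hx =>
      mem_Icc.2 ⟨(mem_Icc.1 (hTn hx)).1, hj.2 (mem_coe.2 hx)⟩
    have hjT : j ∈ T := mem_coe.1 hj.1
    have h1 := (card_inter_lt_card_sdiff_iff hT hinter hunion le_rfl).1 (hmaj j hj4 le_rfl)
    rw [if_neg (lt_irrefl _)] at h1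
    have h2 := prefixCard_self_le T j
    refine ⟨j, (mem_Icc.1 (hTn hjT)).2, ⟨hT, hjT, hTk, fun i hi hij => ?_,
      Or.inl ⟨by omega, h1⟩⟩, hinter, hunion⟩
    have h3 := (card_inter_lt_card_sdiff_iff hT hinter hunion hij.le).1 (hmaj i hi hij.le)
    rwa [if_pos hij] at h3
  · refine ⟨4, by omega, ⟨by decide, by decide, ?_, fun i h1 h2 => by omega,
      Or.inr ⟨rfl, rfl⟩⟩, by decide, by decide⟩
    exact le_trans (by decide) hk

lemma ResistantWord.exists_isResistantPair {n k j : ℕ} {T : Finset ℕ} (h : ResistantWord k T j)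
    (hjn : j ≤ n) : ∃ S, IsResistantPair n k S T := by
  have hTn : T ⊆ Icc 2 n := h.1.trans (Icc_subset_Icc le_rfl hjn)
  have h4 := h.four_le
  rcases h.2.2.2.2 with ⟨h5, hend⟩ | ⟨rfl, hT⟩
  · have hj2 := h.le_of_mem h.2.1
    have hinter : insert j (Icc 1 j \ T) ∩ T = {j} := by
      ext x
      have := h.2.1
      simp only [mem_inter, mem_insert, mem_sdiff, mem_singleton]
      grind
    have hunion : insert j (Icc 1 j \ T) ∪ T = Icc 1 j := by
      ext x
      have h3 : x ∈ T → 2 ≤ x ∧ x ≤ j := h.le_of_mem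
      simp only [mem_union, mem_insert, mem_sdiff, mem_Icc]
      grind
    refine ⟨insert j (Icc 1 j \ T), ?_, hTn, Or.inl ⟨j, h4, ⟨h.2.1, fun x hx =>
      (h.le_of_mem (mem_coe.1 hx)).2⟩, hinter, hunion, ?_, h.2.2.1, fun i hi hij => ?_⟩⟩
    · exact (subset_union_left.trans hunion.subset).trans (Icc_subset_Icc le_rfl hjn)
    · have h6 : T ⊆ Icc 1 j := h.1.trans (Icc_subset_Icc (by omega) le_rfl)
      have h7 := card_insert_le j (Icc 1 j \ T)
      rw [card_sdiff_of_subset h6, Nat.card_Icc] at h7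
      have h8 := prefixCard_le_card T j
      have h9 := h.2.2.1
      omega
    · rw [card_inter_lt_card_sdiff_iff h.1 hinter hunion hij]
      split_ifs with hij'
      · exact h.2.2.2.1 i hi hij'
      · exact hend
  · refine ⟨{1, 4}, ?_, hTn, Or.inr ⟨rfl, hT⟩⟩
    intro x hx
    simp only [mem_insert, mem_singleton] at hx
    rw [mem_Icc]
    omega

lemma IsResistantEnumeration.lexLT {n k m : ℕ} {S T : ℕ → Finset ℕ}
    (h : IsResistantEnumeration n k m S T) {a b : ℕ} (hab : a < b) (hb : b ≤ m) :
    LexLT (T a) (T b) := by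
  induction b, hab using Nat.le_induction with
  | base => exact h.lt_succ a (by omega)
  | succ c hc ih => exact (ih (by omega)).trans (h.lt_succ c (by omega))

lemma IsResistantEnumeration.exists_resistantWord {n k m l : ℕ} {S T : ℕ → Finset ℕ}
    (h : IsResistantEnumeration n k m S T) (hk : 3 ≤ k) (hn : 2 * k < n) (hl : 1 ≤ l)
    (hlm : l ≤ m) :
    ∃ j ≤ n, ResistantWord k (T l) j ∧ S l ∩ T l = {j} ∧ S l ∪ T l = Icc 1 j :=
  ((h.pair_iff _ _).2 ⟨l, hl, hlm, rfl, rfl⟩).exists_resistantWord hk hn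

lemma IsResistantEnumeration.subset {n k m l : ℕ} {S T : ℕ → Finset ℕ}
    (h : IsResistantEnumeration n k m S T) (hlm : l ≤ m) : T l ⊆ Icc 2 n := by
  rcases Nat.eq_zero_or_pos l with rfl | hl
  · exact h.T_zero.subset
  · exact ((h.pair_iff _ _).2 ⟨l, hl, hlm, rfl, rfl⟩).2.1

/-- No resistant word lies strictly between two consecutive members of the enumeration. -/
lemma IsResistantEnumeration.not_between {n k m l j : ℕ} {S T : ℕ → Finset ℕ} {V : Finset ℕ}
    (h : IsResistantEnumeration n k m S T) (hlm : l ≤ m) (hV : ResistantWord k V j) (hj : j ≤ n)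
    (h1 : LexLT (T (l - 1)) V) : ¬ LexLT V (T l) := by
  intro h2
  obtain ⟨P, hP⟩ := hV.exists_isResistantPair hj
  obtain ⟨i, hi, him, -, rfl⟩ := (h.pair_iff _ _).1 hP
  rcases lt_or_ge i l with hil | hil
  · rcases (show i ≤ l - 1 by omega).eq_or_lt with rfl | hlt
    · exact h1.2 rfl
    · exact (h1.trans (h.lexLT hlt (by omega))).2 rfl
  · rcases hil.eq_or_lt with rfl | hlt
    · exact h2.2 rfl
    · exact (h2.trans (h.lexLT hlt him)).2 rfl

/-- The total size of the two families of a resistant pair is governed by the gain of `T`. -/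
lemma card_lexFamily_add_card_lexFamily {n k j : ℕ} {S T : Finset ℕ} (hk : 1 ≤ k)
    (hn : 2 * k < n) (hT : ResistantWord k T j) (hj : j ≤ n) (hinter : S ∩ T = {j})
    (hunion : S ∪ T = Icc 1 j) :
    (#(lexFamily n S (k - 1)) + #(lexFamily n T k) : ℤ) =
      (n - 1).choose (k - 1) - gainLE n k T j := by
  have h4 := hT.four_le
  rw [card_lexFamily_partner hk (by omega) (by omega) hj hinter hunion,
    card_lexFamily_eq_countLE (by omega) hj hT.1, gainLE]
  ring

lemma card_lexFamily_pair_last {n r : ℕ} (hr : 1 ≤ r) (hn : 2 ≤ n) :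
    #(lexFamily n {1, n} r) = (n - 1).choose r := by
  classical
  have h1 : ({1, n} : Finset ℕ) ∩ Icc 2 n = {n} := by
    ext x; simp only [mem_inter, mem_insert, mem_singleton, mem_Icc]; omega
  rw [lexFamily, h1, filter_true_of_mem, card_powersetCard, Nat.card_Icc]
  · congr 1
  · intro A hA
    obtain ⟨hA, hAr⟩ := mem_powersetCard.1 hA
    by_cases hnA : n ∈ A
    · exact Or.inl (singleton_subset_iff.2 hnA)
    · obtain ⟨a, ha⟩ := card_pos.1 (show 0 < #A by omega)
      have h2 := mem_Icc.1 (hA ha)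
      have h3 : a ≠ n := fun h => hnA (h ▸ ha)
      refine Or.inr ⟨a, mem_sdiff.2 ⟨ha, by simpa using h3⟩, fun b hb => ?_⟩
      have := mem_singleton.1 (mem_sdiff.1 hb).1
      omega

/-- The sizes attached to consecutive resistant pairs decrease strictly; for the first pair this only
says that its gain is positive. -/
lemma IsResistantEnumeration.card_lt {n k m l : ℕ} {S T : ℕ → Finset ℕ}
    (h : IsResistantEnumeration n k m S T) (hk : 3 ≤ k) (hn : 2 * k < n) (hl : 1 ≤ l)
    (hlm : l ≤ m) :
    #(lexFamily n (S l) (k - 1)) + #(lexFamily n (T l) k) <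
      #(lexFamily n (S (l - 1)) (k - 1)) + #(lexFamily n (T (l - 1)) k) := by
  obtain ⟨j, hj, hT, hinter, hunion⟩ := h.exists_resistantWord hk hn hl hlm
  have h1 := card_lexFamily_add_card_lexFamily (by omega) hn hT hj hinter hunion
  rcases Nat.eq_zero_or_pos (l - 1) with h0 | h0
  · rw [h0, h.S_zero, card_lexFamily_pair_last (by omega) (by omega)]
    have := hT.gainLE_pos hn hj
    omega
  · obtain ⟨i, hi, hV, hinter', hunion'⟩ :=
      h.exists_resistantWord hk hn h0 (show l - 1 ≤ m by omega)
    have h2 := card_lexFamily_add_card_lexFamily (by omega) hn hV hi hinter' hunion'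
    have h3 := h.lexLT (show l - 1 < l by omega) hlm
    have := ResistantWord.gainLE_lt_gainLE hn hV hT hi hj h3.2 h3.1
    omega

/-- If the last set `U` of an initial segment lies between two consecutive resistant words, the later
one is the longest resistant truncation of `U`, and so its gain is no larger. -/
lemma IsResistantEnumeration.gainLE_le {n k m l j : ℕ} {S T : ℕ → Finset ℕ} {U : Finset ℕ}
    (h : IsResistantEnumeration n k m S T) (hn : 2 * k < n) (hlm : l ≤ m)
    (hT : ResistantWord k (T l) j) (hj : j ≤ n) (hU : U ⊆ Icc 2 n) (hUk : #U ≤ k)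
    (h1 : LexLT (T (l - 1)) U) (h2 : LexLE U (T l)) :
    gainLE n k (T l) j ≤ gainLE n k U n := by
  have hU2 : ∀ x ∈ U, 2 ≤ x := fun x hx => (mem_Icc.1 (hU hx)).1
  have hlt : ∀ t, LexLT (T (l - 1)) (U ∩ Icc 2 t) := fun t => h1.trans_le (Or.inl inter_subset_left)
  have hagree : ∀ x, 2 ≤ x → x ≤ j → (x ∈ U ↔ x ∈ T l) := by
    rcases agree_or_exists_first_diff U (T l) j with h' | ⟨t, ht2, htj, hne, hag⟩
    · exact h'
    · exfalso
      have htU : t ∈ U := by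
        by_contra htU
        exact not_prefixLE_of_first_diff ht2 htj htU (by tauto) hag
          ((lexLE_iff_prefixLE hT.1 hU).1 h2)
      have htT : t ∉ T l := by tauto
      have htj' : t < j := lt_of_le_of_ne htj fun e => htT (e ▸ hT.2.1)
      have hV := hT.truncate_of_agree htj' hag ht2 htU htT hUk
      refine h.not_between hlm hV (by omega) (hlt t) (lexLT_iff.2 ⟨t, ?_, htT, fun x hx => ?_⟩)
      · exact mem_inter.2 ⟨htU, mem_Icc.2 ⟨ht2, le_rfl⟩⟩
      · rw [mem_inter, mem_Icc]
        by_cases hx2 : 2 ≤ x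
        · rw [hag x hx2 hx]
          simp [hx2, hx.le]
        · exact iff_of_false (fun h => hx2 (hU2 x h.1)) fun h => hx2 (hT.le_of_mem h).1
  rw [← gainLE_congr hagree]
  refine gainLE_le_of_no_resistant_truncation hn hUk hT.four_le hj (fun i hi hij => ?_)
    fun t hjt htn hV => ?_
  · rw [prefixCard_congr fun x hx hx' => hagree x hx (hx'.trans hij)]
    rcases hij.eq_or_lt with rfl | hij
    · have := hT.prefixCard_end; omega
    · exact hT.2.2.2.1 i hi hij
  · refine h.not_between hlm hV htn (hlt t) ⟨Or.inl fun x hx => ?_, fun e => ?_⟩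
    · have hx' := hT.le_of_mem hx
      exact mem_inter.2 ⟨(hagree x hx'.1 hx'.2).2 hx, mem_Icc.2 ⟨hx'.1, by omega⟩⟩
    · have := (hT.le_of_mem (e ▸ hV.2.1)).2
      omega

/-- The bound for cross-intersecting families: pass to an initial segment of the `k`-sets, and then to
the resistant truncation of its last member. -/
lemma IsResistantEnumeration.card_add_card_le {n k m l : ℕ} {S T : ℕ → Finset ℕ}
    (h : IsResistantEnumeration n k m S T) (hk : 3 ≤ k) (hn : 2 * k < n) (hl : 1 ≤ l)
    (hlm : l ≤ m) {𝒜 ℬ : Finset (Finset ℕ)} (h𝒜 : 𝒜 ⊆ powersetCard (k - 1) (Icc 2 n))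
    (hℬ : ℬ ⊆ powersetCard k (Icc 2 n)) (hcross : CrossIntersecting 𝒜 ℬ)
    (hlower : #(lexFamily n (T (l - 1)) k) < #ℬ) (hupper : #ℬ ≤ #(lexFamily n (T l) k)) :
    #𝒜 + #ℬ ≤ #(lexFamily n (S l) (k - 1)) + #(lexFamily n (T l) k) := by
  obtain ⟨j, hj, hT, hinter, hunion⟩ := h.exists_resistantWord hk hn hl hlm
  obtain ⟨U, hU, hUℬ, hU𝒜⟩ := hcross.exists_countLE (by omega) hn h𝒜 hℬ (card_pos.1 (by omega))
  obtain ⟨hU, hUk⟩ := mem_powersetCard.1 hU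
  have hcard : #ℬ = #(lexFamily n U k) := by
    have := card_lexFamily_eq_countLE (r := k) (show 1 ≤ n by omega) le_rfl hU
    omega
  have h1 : LexLT (T (l - 1)) U := by
    rcases lexLE_or_lexLT U (T (l - 1)) with h' | h'
    · have := card_le_card (lexFamily_subset (r := k) hU (h.subset (by omega)) h')
      omega
    · exact h'
  have h2 : LexLE U (T l) := by
    rcases lexLE_or_lexLT U (T l) with h' | h'
    · exact h'
    · have := card_lexFamily_lt (h.subset hlm) hU hUk h'
      omega
  have h3 := h.gainLE_le hn hlm hT hj hU hUk.le h1 h2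
  have h4 := card_lexFamily_add_card_lexFamily (by omega) hn hT hj hinter hunion
  have h5 : gainLE n k U n = countLE n (n - k) U n - countLE n k U n := rfl
  omega

/-! ### Diversity of intersecting families -/

/-- An intersecting family splits, according to membership of an element of maximal degree, into two
cross-intersecting families; the size of the second one is the diversity. -/
lemma exists_crossIntersecting_of_intersecting {n k : ℕ} (hn : 1 ≤ n) {ℱ : Finset (Finset ℕ)}
    (hℱ : ℱ ⊆ powersetCard k (Icc 1 n)) (hint : (ℱ : Set (Finset ℕ)).Intersecting) :
    ∃ 𝒜 ⊆ powersetCard (k - 1) (Icc 2 n), ∃ ℬ ⊆ powersetCard k (Icc 2 n),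
      CrossIntersecting 𝒜 ℬ ∧ #ℬ = diversity n ℱ ∧ #ℱ = #𝒜 + #ℬ := by
  obtain ⟨i, hi, hdeg⟩ := exists_mem_eq_sup (Icc 1 n) ⟨1, mem_Icc.2 ⟨le_rfl, hn⟩⟩ (familyDegree ℱ)
  rw [mem_Icc] at hi
  -- move the element of maximal degree to `1`
  set σ := Equiv.swap 1 i
  have hmap : ∀ F ∈ ℱ, F.map σ.toEmbedding ⊆ Icc 1 n ∧ #(F.map σ.toEmbedding) = k := by
    intro F hF
    obtain ⟨h1, h2⟩ := mem_powersetCard.1 (hℱ hF)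
    refine ⟨fun y hy => ?_, by rw [card_map, h2]⟩
    obtain ⟨x, hx, rfl⟩ := mem_map.1 hy
    have := mem_Icc.1 (h1 hx)
    rw [mem_Icc, Equiv.coe_toEmbedding, Equiv.swap_apply_def]
    split_ifs <;> omega
  have h1mem : ∀ F : Finset ℕ, 1 ∈ F.map σ.toEmbedding ↔ i ∈ F := by
    intro F
    rw [mem_map_equiv, Equiv.symm_swap, Equiv.swap_apply_left]
  have h2 : ∀ x ∈ Icc 1 n, x ≠ 1 → x ∈ Icc 2 n := fun x hx hx' => by
    rw [mem_Icc] at *; omega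
  have hsum := card_filter_add_card_filter_not (s := ℱ) fun F => i ∈ F
  have hA : #(({F ∈ ℱ | i ∈ F}).image fun F => (F.map σ.toEmbedding).erase 1) =
      #{F ∈ ℱ | i ∈ F} := by
    refine card_image_of_injOn fun F hF G hG h => map_injective σ.toEmbedding ?_
    have h3 := (h1mem F).2 (mem_filter.1 (mem_coe.1 hF)).2
    have h4 := (h1mem G).2 (mem_filter.1 (mem_coe.1 hG)).2
    rw [← insert_erase h3, ← insert_erase h4]
    exact congrArg (insert 1) h
  have hB : #(({F ∈ ℱ | i ∉ F}).image fun F => F.map σ.toEmbedding) = #{F ∈ ℱ | i ∉ F} :=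
    card_image_of_injective _ (map_injective σ.toEmbedding)
  refine ⟨({F ∈ ℱ | i ∈ F}).image fun F => (F.map σ.toEmbedding).erase 1, ?_,
    ({F ∈ ℱ | i ∉ F}).image fun F => F.map σ.toEmbedding, ?_, ?_, ?_, ?_⟩
  · intro A hA
    obtain ⟨F, hF, rfl⟩ := mem_image.1 hA
    obtain ⟨hF, hiF⟩ := mem_filter.1 hF
    refine mem_powersetCard.2 ⟨fun x hx => ?_, ?_⟩
    · rw [mem_erase] at hx
      exact h2 x ((hmap F hF).1 hx.2) hx.1
    · rw [card_erase_of_mem ((h1mem F).2 hiF), (hmap F hF).2]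
  · intro B hB
    obtain ⟨F, hF, rfl⟩ := mem_image.1 hB
    obtain ⟨hF, hiF⟩ := mem_filter.1 hF
    exact mem_powersetCard.2 ⟨fun x hx => h2 x ((hmap F hF).1 hx)
      fun e => hiF ((h1mem F).1 (e ▸ hx)), (hmap F hF).2⟩
  · intro A hA B hB
    obtain ⟨F, hF, rfl⟩ := mem_image.1 hA
    obtain ⟨G, hG, rfl⟩ := mem_image.1 hB
    rw [mem_filter] at hF hG
    obtain ⟨x, hx⟩ := not_disjoint_iff_nonempty_inter.1 (hint hF.1 hG.1)
    rw [mem_inter] at hx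
    have h3 : σ x ∈ F.map σ.toEmbedding := mem_map_of_mem _ hx.1
    have h4 : σ x ∈ G.map σ.toEmbedding := mem_map_of_mem _ hx.2
    exact ⟨σ x, mem_inter.2 ⟨mem_erase.2 ⟨fun e => hG.2 ((h1mem G).1 (e ▸ h4)), h3⟩, h4⟩⟩
  · rw [hB, diversity, familyMaxDegree, hdeg, familyDegree]
    omega
  · rw [hA, hB, hsum]

theorem mainTheorem1 (n k : ℕ) (hk : 6 ≤ 2 * k) (hn : 2 * k < n)
    (m : ℕ) (S T : ℕ → Finset ℕ) (hST : IsResistantEnumeration n k m S T) :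
    (∀ l, 1 ≤ l → l ≤ m →
      #(lexFamily n (S l) (k - 1)) + #(lexFamily n (T l) k) <
        #(lexFamily n (S (l - 1)) (k - 1)) + #(lexFamily n (T (l - 1)) k)) ∧
    (∀ l, 1 ≤ l → l ≤ m →
      ∀ 𝒜 ℬ : Finset (Finset ℕ),
        𝒜 ⊆ powersetCard (k - 1) (Icc 2 n) → ℬ ⊆ powersetCard k (Icc 2 n) →
        CrossIntersecting 𝒜 ℬ →
        #(lexFamily n (T (l - 1)) k) < #ℬ → #ℬ ≤ #(lexFamily n (T l) k) →
        #𝒜 + #ℬ ≤ #(lexFamily n (S l) (k - 1)) + #(lexFamily n (T l) k)) ∧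
    (∀ l, 1 ≤ l → l ≤ m →
      ∀ ℱ : Finset (Finset ℕ),
        ℱ ⊆ powersetCard k (Icc 1 n) → (ℱ : Set (Finset ℕ)).Intersecting →
        #(lexFamily n (T (l - 1)) k) < diversity n ℱ →
        diversity n ℱ ≤ #(lexFamily n (T l) k) →
        #ℱ ≤ #(lexFamily n (S l) (k - 1)) + #(lexFamily n (T l) k)) := by
  refine ⟨fun l hl hlm => hST.card_lt (by omega) hn hl hlm, ?_, ?_⟩
  · intro l hl hlm 𝒜 ℬ h𝒜 hℬ hcross hlower hupper
    exact hST.card_add_card_le (by omega) hn hl hlm h𝒜 hℬ hcross hlower hupper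
  · intro l hl hlm ℱ hℱ hint hlower hupper
    obtain ⟨𝒜, h𝒜, ℬ, hℬ, hcross, hdiv, hsum⟩ :=
      exists_crossIntersecting_of_intersecting (by omega) hℱ hint
    rw [← hdiv] at hlower hupper
    rw [hsum]
    exact hST.card_add_card_le (by omega) hn hl hlm h𝒜 hℬ hcross hlower hupper
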